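/- **Setting.** Let $N,n,m$ be non-negative integers, $(\Omega,\mathfrak F,\mathbb P)$ a probability space and $\omega_0,\dots,\omega_{N-1}$ real square-integrable random variables with $\mathbb E[\omega_k\mid\sigma(\omega_0,\dots,\omega_{k-1})]=0$ and $\mathbb E[\omega_k^2\mid\sigma(\omega_0,\dots,\omega_{k-1})]=1$. An *initial state at time* $l\in\{0,\dots,N-1\}$ is a square-integrable $\mathbb R^n$-valued random vector $\xi$ independent of $(\omega_l,\dots,\omega_{N-1})$; we assume that at time $0$ there is at least one initial state that is not almost surely constant. An *admissible control* for $(l,\xi)$ is a family $u=(u_l,\dots,u_{N-1})$ of square-integrable $\mathbb R^m$-valued random vectors such that $u_k$ is measurable with respect to $\sigma(\xi,\omega_l,\dots,\omega_{k-1})$. The state is given by $x_l=\xi$ and, for $k=l,\dots,N-1$, $$x_{k+1}=A_kx_k+\bar A_k\mathbb Ex_k+B_ku_k+\bar B_k\mathbb Eu_k+b_k+\big(C_kx_k+\bar C_k\mathbb Ex_k+D_ku_k+\bar D_k\mathbb Eu_k+\sigma_k\big)\omega_k ,$$ and the cost is $$\begin{aligned}J(l,\xi;u)=\mathbb E\Big\{&\langle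 Gx_N,x_N\rangle+2\langle g,x_N\rangle+\langle\bar G\,\mathbb Ex_N,\mathbb Ex_N\rangle+2\langle\bar g,\mathbb Ex_N\rangle\\ &+\sum_{k=l}^{N-1}\big[\langle Q_kx_k,x_k\rangle+2\langle S_kx_k,u_k\rangle+\langle R_ku_k,u_k\rangle+2\langle q_k,x_k\rangle+2\langle\rho_k,u_k\rangle\big]\\ &+\sum_{k=l}^{N-1}\big[\langle\bar Q_k\mathbb Ex_k,\mathbb Ex_k\rangle+2\langle\bar S_k\mathbb Ex_k,\mathbb Eu_k\rangle+\langle\bar R_k\mathbb Eu_k,\mathbb Eu_k\rangle+2\langle\bar q_k,\mathbb Ex_k\rangle+2\langle\bar\rho_k,\mathbb Eu_k\rangle\big]\Big\}.\end{aligned}$$ All matrices and $b_k,\sigma_k$ are deterministic; $Q_k,\bar Q_k,R_k,\bar R_k,G,\bar G$ are symmetric (no definiteness is assumed), $S_k,\bar S_k\in\mathbb R^{m\times n}$; $q_k,\bar q_k,\rho_k,\bar\rho_k,g,\bar g$ are square-integrable random vectors. A *closed-loop strategy* on $\{l,\dots,N-1\}$ is a family of deterministic $\Theta_k,\bar\Theta_k\in\mathbb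 R^{m\times n}$, $v_k\in\mathbb R^m$. It is *optimal* if for every initial state $\xi$ at time $l$ the control $u^*_k=\Theta_kx^*_k+\bar\Theta_k\mathbb Ex^*_k+v_k$, where $x^*$ is the state process that results from this feedback with $x^*_l=\xi$, satisfies $J(l,\xi;u^*)\le J(l,\xi;u)$ for all admissible $u$. Problem (MF-LQ) is *closed-loop solvable* if for every $l\in\{0,\dots,N-1\}$ there is an optimal closed-loop strategy on $\{l,\dots,N-1\}$ (one strategy for all $\xi$). For $P_k,\Pi_k\in\mathbb R^{n\times n}$, $k=0,\dots,N$, put $$\begin{aligned}\Upsilon_k&=R_k+B_k'P_{k+1}B_k+D_k'P_{k+1}D_k,\\ \bar\Upsilon_k&=R_k+\bar R_k+(B_k+\bar B_k)'\Pi_{k+1}(B_k+\bar B_k)+(D_k+\bar D_k)'P_{k+1}(D_k+\bar D_k),\\ H_k&=B_k'P_{k+1}A_k+D_k'P_{k+1}C_k+S_k,\\ \bar H_k&=(B_k+\bar B_k)'\Pi_{k+1}(A_k+\bar A_k)+(D_k+\bar D_k)'P_{k+1}(C_k+\bar C_k)+S_k+\bar S_k.\end{aligned}$$ The *generalized Riccati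 equations* (GRE) are, with $\dagger$ the Moore–Penrose pseudo-inverse and $k=0,\dots,N-1$, $$\begin{aligned}P_k&=Q_k+A_k'P_{k+1}A_k+C_k'P_{k+1}C_k-H_k'\Upsilon_k^\dagger H_k,\qquad P_N=G,\\ \Pi_k&=Q_k+\bar Q_k+(A_k+\bar A_k)'\Pi_{k+1}(A_k+\bar A_k)+(C_k+\bar C_k)'P_{k+1}(C_k+\bar C_k)-\bar H_k'\bar\Upsilon_k^\dagger\bar H_k,\qquad \Pi_N=G+\bar G.\end{aligned}$$ **Theorem 4.3.** If Problem (MF-LQ) is closed-loop solvable, then the GRE is regularly solvable: it has a solution $(P,\Pi)$ such that for all $k=0,\dots,N-1$ one has $\Upsilon_k\ge0$, $\bar\Upsilon_k\ge0$, $\mathcal R(H_k)\subseteq\mathcal R(\Upsilon_k)$, $\mathcal R(\bar H_k)\subseteq\mathcal R(\bar\Upsilon_k)$, and moreover $\Upsilon^\dagger H$ and $\bar\Upsilon^\dagger\bar H$ belong to $L^2(\{0,\dots,N-1\};\mathbb R^{m\times n})$. -/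

import Mathlib

open MeasureTheory ProbabilityTheory Matrix

noncomputable section

namespace MFLQ

/-! ### The Moore-Penrose pseudo-inverse of a real matrix -/

/-- The four Penrose equations: `X` is the Moore-Penrose pseudo-inverse of `M`. -/
structure IsPseudoInverse {p r : ℕ} (M : Matrix (Fin p) (Fin r) ℝ)
    (X : Matrix (Fin r) (Fin p) ℝ) : Prop where
  mul_mul_self : M * X * M = M
  self_mul_mul : X * M * X = X
  symm_left : (M * X)ᵀ = M * X
  symm_right : (X * M)ᵀ = X * M

theorem IsPseudoInverse.unique {p r : ℕ} {M : Matrix (Fin p) (Fin r) ℝ}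
    {X Y : Matrix (Fin r) (Fin p) ℝ} (hX : IsPseudoInverse M X) (hY : IsPseudoInverse M Y) :
    X = Y := by
  have h1 : M * X = M * Y := by
    calc M * X = (M * X)ᵀ := hX.symm_left.symm
      _ = ((M * Y) * (M * X))ᵀ := by rw [← Matrix.mul_assoc, hY.mul_mul_self]
      _ = (M * X) * (M * Y) := by rw [Matrix.transpose_mul, hX.symm_left, hY.symm_left]
      _ = M * Y := by rw [← Matrix.mul_assoc, hX.mul_mul_self]
  have h2 : X * M = Y * M := by
    calc X * M = (X * M)ᵀ := hX.symm_right.symm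
      _ = ((X * M) * (Y * M))ᵀ := by
        rw [Matrix.mul_assoc, ← Matrix.mul_assoc M, hY.mul_mul_self]
      _ = (Y * M) * (X * M) := by rw [Matrix.transpose_mul, hX.symm_right, hY.symm_right]
      _ = Y * M := by rw [Matrix.mul_assoc, ← Matrix.mul_assoc M, hX.mul_mul_self]
  calc X = X * M * X := hX.self_mul_mul.symm
    _ = Y * (M * X) := by rw [h2, Matrix.mul_assoc]
    _ = Y := by rw [h1, ← Matrix.mul_assoc, hY.self_mul_mul]

theorem exists_isPseudoInverse_of_isHermitian {r : ℕ} (H : Matrix (Fin r) (Fin r) ℝ)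
    (hH : H.IsHermitian) :
    ∃ K : Matrix (Fin r) (Fin r) ℝ, Kᵀ = K ∧ K * H = H * K ∧ H * K * H = H ∧ K * H * K = K := by
  set U : Matrix (Fin r) (Fin r) ℝ := (hH.eigenvectorUnitary : Matrix (Fin r) (Fin r) ℝ) with hU
  set e : Fin r → ℝ := hH.eigenvalues
  have hUU : Uᵀ * U = 1 := by
    have := Unitary.coe_star_mul_self hH.eigenvectorUnitary
    simpa [Matrix.star_eq_conjTranspose] using this
  have hsp : H = U * diagonal e * Uᵀ := by
    have := hH.spectral_theorem
    simpa [Unitary.conjStarAlgAut_apply, Matrix.star_eq_conjTranspose, Function.comp_def] using this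
  have key : ∀ d f : Fin r → ℝ, (U * diagonal d * Uᵀ) * (U * diagonal f * Uᵀ)
      = U * diagonal (fun i => d i * f i) * Uᵀ := by
    intro d f
    calc (U * diagonal d * Uᵀ) * (U * diagonal f * Uᵀ)
        = U * diagonal d * (Uᵀ * U) * diagonal f * Uᵀ := by simp only [Matrix.mul_assoc]
      _ = _ := by rw [hUU, Matrix.mul_one, Matrix.mul_assoc U, diagonal_mul_diagonal]
  refine ⟨U * diagonal (fun i => (e i)⁻¹) * Uᵀ, ?_, ?_, ?_, ?_⟩
  · simp [Matrix.transpose_mul, Matrix.mul_assoc]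
  · rw [hsp, key, key]; simp only [mul_comm]
  · rw [hsp, key, key]; simp only [mul_inv_mul_cancel]
  · rw [hsp, key, key]
    congr 3; funext i
    by_cases h : e i = 0 <;> simp [h]

theorem exists_isPseudoInverse {p r : ℕ} (M : Matrix (Fin p) (Fin r) ℝ) :
    ∃ X : Matrix (Fin r) (Fin p) ℝ, IsPseudoInverse M X := by
  have hH : (Mᵀ * M).IsHermitian := by
    simpa using Matrix.isHermitian_conjTranspose_mul_self M
  obtain ⟨K, hKt, hcomm, hHKH, hKHK⟩ := exists_isPseudoInverse_of_isHermitian (Mᵀ * M) hH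
  have h0 : M * (1 - K * (Mᵀ * M)) = 0 := by
    have : Mᵀ * M * (1 - K * (Mᵀ * M)) = 0 := by
      rw [Matrix.mul_sub, Matrix.mul_one, ← Matrix.mul_assoc, hHKH, sub_self]
    have h2 := (Matrix.conjTranspose_mul_self_mul_eq_zero M (1 - K * (Mᵀ * M))).1
      (by simpa using this)
    exact h2
  have h1 : M * (K * (Mᵀ * M)) = M := by
    rw [Matrix.mul_sub, Matrix.mul_one, sub_eq_zero] at h0; exact h0.symm
  refine ⟨K * Mᵀ, ?_, ?_, ?_, ?_⟩
  · simpa only [Matrix.mul_assoc] using h1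
  · calc K * Mᵀ * M * (K * Mᵀ) = K * (Mᵀ * M) * K * Mᵀ := by simp only [Matrix.mul_assoc]
      _ = K * Mᵀ := by rw [hKHK]
  · simp only [Matrix.transpose_mul, Matrix.transpose_transpose, hKt, Matrix.mul_assoc]
  · calc (K * Mᵀ * M)ᵀ = (Mᵀ * M) * K := by
          simp only [Matrix.transpose_mul, Matrix.transpose_transpose, hKt, Matrix.mul_assoc]
      _ = K * Mᵀ * M := by rw [← hcomm, Matrix.mul_assoc]

/-- The Moore-Penrose pseudo-inverse `M†`. -/
def pinv {p r : ℕ} (M : Matrix (Fin p) (Fin r) ℝ) : Matrix (Fin r) (Fin p) ℝ :=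
  Classical.choose (exists_isPseudoInverse M)

theorem pinv_spec {p r : ℕ} (M : Matrix (Fin p) (Fin r) ℝ) : IsPseudoInverse M (pinv M) :=
  Classical.choose_spec (exists_isPseudoInverse M)

/-! ### Data of the mean-field linear-quadratic problem -/

/-- Coefficients, weights and noise. Only the times `k < N` matter (`k ≤ N` for the state). The
name with suffix `b` is the coefficient with a bar, the one multiplying expectations. -/
structure Data (Ω : Type*) (n m : ℕ) where
  /-- the horizon -/
  N : ℕ
  A : ℕ → Matrix (Fin n) (Fin n) ℝ
  Ab : ℕ → Matrix (Fin n) (Fin n) ℝ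
  B : ℕ → Matrix (Fin n) (Fin m) ℝ
  Bb : ℕ → Matrix (Fin n) (Fin m) ℝ
  C : ℕ → Matrix (Fin n) (Fin n) ℝ
  Cb : ℕ → Matrix (Fin n) (Fin n) ℝ
  D : ℕ → Matrix (Fin n) (Fin m) ℝ
  Db : ℕ → Matrix (Fin n) (Fin m) ℝ
  /-- inhomogeneous drift term -/
  b : ℕ → Fin n → ℝ
  /-- inhomogeneous diffusion term -/
  σ : ℕ → Fin n → ℝ
  Q : ℕ → Matrix (Fin n) (Fin n) ℝ
  Qb : ℕ → Matrix (Fin n) (Fin n) ℝ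
  S : ℕ → Matrix (Fin m) (Fin n) ℝ
  Sb : ℕ → Matrix (Fin m) (Fin n) ℝ
  R : ℕ → Matrix (Fin m) (Fin m) ℝ
  Rb : ℕ → Matrix (Fin m) (Fin m) ℝ
  G : Matrix (Fin n) (Fin n) ℝ
  Gb : Matrix (Fin n) (Fin n) ℝ
  q : ℕ → Ω → Fin n → ℝ
  qb : ℕ → Ω → Fin n → ℝ
  ρ : ℕ → Ω → Fin m → ℝ
  ρb : ℕ → Ω → Fin m → ℝ
  g : Ω → Fin n → ℝ
  gb : Ω → Fin n → ℝ
  /-- the scalar noise `ω_k` -/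
  w : ℕ → Ω → ℝ

section Problem

variable {Ω : Type*} {n m : ℕ}

/-- `σ(ω_l, …, ω_{k-1})`. -/
abbrev Data.noiseField (d : Data Ω n m) (l k : ℕ) : MeasurableSpace Ω :=
  ⨆ j ∈ Set.Ico l k, MeasurableSpace.comap (d.w j) inferInstance

/-- `σ(ξ, ω_l, …, ω_{k-1})`: the information available when the control `u_k` is chosen. -/
abbrev Data.infoField (d : Data Ω n m) (ξ : Ω → Fin n → ℝ) (l k : ℕ) : MeasurableSpace Ω :=
  MeasurableSpace.comap ξ inferInstance ⊔ d.noiseField l k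

/-- The symmetry of the quadratic weights (no definiteness is required). -/
structure Data.SymmetricWeights (d : Data Ω n m) : Prop where
  Q : ∀ k < d.N, (d.Q k)ᵀ = d.Q k
  Qb : ∀ k < d.N, (d.Qb k)ᵀ = d.Qb k
  R : ∀ k < d.N, (d.R k)ᵀ = d.R k
  Rb : ∀ k < d.N, (d.Rb k)ᵀ = d.Rb k
  G : d.Gᵀ = d.G
  Gb : d.Gbᵀ = d.Gb

variable [MeasurableSpace Ω]

/-- The linear weights are square integrable random vectors. -/
structure Data.SquareIntegrableWeights (d : Data Ω n m) (P : Measure Ω) : Prop where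
  q : ∀ k < d.N, MemLp (d.q k) 2 P
  qb : ∀ k < d.N, MemLp (d.qb k) 2 P
  ρ : ∀ k < d.N, MemLp (d.ρ k) 2 P
  ρb : ∀ k < d.N, MemLp (d.ρb k) 2 P
  g : MemLp d.g 2 P
  gb : MemLp d.gb 2 P

/-- `ω_0, …, ω_{N-1}` is a martingale difference sequence with conditional variance one. -/
structure Data.IsMartingaleDifference (d : Data Ω n m) (P : Measure Ω) : Prop where
  measurable : ∀ k < d.N, Measurable (d.w k)
  memLp : ∀ k < d.N, MemLp (d.w k) 2 P
  condExp_eq_zero : ∀ k < d.N, P[d.w k | d.noiseField 0 k] =ᵐ[P] fun _ => 0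
  condExp_sq_eq_one : ∀ k < d.N,
    P[fun ω => d.w k ω ^ 2 | d.noiseField 0 k] =ᵐ[P] fun _ => 1

/-- `ξ` is an admissible initial state at time `l`: a square integrable random vector that is
independent of the noise `ω_l, …, ω_{N-1}`. -/
structure Data.IsInitialState (d : Data Ω n m) (P : Measure Ω) (l : ℕ) (ξ : Ω → Fin n → ℝ) :
    Prop where
  measurable : Measurable ξ
  memLp : MemLp ξ 2 P
  indep : Indep (MeasurableSpace.comap ξ inferInstance) (d.noiseField l d.N) P

/-- The class of admissible controls for the initial pair `(l, ξ)`. -/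
def Data.Admissible (d : Data Ω n m) (P : Measure Ω) (l : ℕ) (ξ : Ω → Fin n → ℝ)
    (u : ℕ → Ω → Fin m → ℝ) : Prop :=
  ∀ k, l ≤ k → k < d.N → Measurable[d.infoField ξ l k] (u k) ∧ MemLp (u k) 2 P

/-- One step of the controlled mean-field system. -/
def Data.step (d : Data Ω n m) (P : Measure Ω) (k : ℕ) (x : Ω → Fin n → ℝ) (u : Ω → Fin m → ℝ) :
    Ω → Fin n → ℝ := fun ω =>
  d.A k *ᵥ x ω + d.Ab k *ᵥ (∫ ω', x ω' ∂P) + d.B k *ᵥ u ω + d.Bb k *ᵥ (∫ ω', u ω' ∂P) + d.b k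
    + d.w k ω • (d.C k *ᵥ x ω + d.Cb k *ᵥ (∫ ω', x ω' ∂P) + d.D k *ᵥ u ω
        + d.Db k *ᵥ (∫ ω', u ω' ∂P) + d.σ k)

/-- The state process started at time `l` from `ξ` under the control `u`
(at times `k ≤ l` it has the value `ξ`). -/
def Data.state (d : Data Ω n m) (P : Measure Ω) (l : ℕ) (ξ : Ω → Fin n → ℝ)
    (u : ℕ → Ω → Fin m → ℝ) : ℕ → Ω → Fin n → ℝ
  | 0 => ξ
  | k + 1 => if k < l then ξ else d.step P k (d.state P l ξ u k) (u k)

/-- The cost functional `J(l, ξ; u)`. -/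
def Data.cost (d : Data Ω n m) (P : Measure Ω) (l : ℕ) (ξ : Ω → Fin n → ℝ)
    (u : ℕ → Ω → Fin m → ℝ) : ℝ :=
  let x := d.state P l ξ u
  let Ex : ℕ → Fin n → ℝ := fun k => ∫ ω, x k ω ∂P
  let Eu : ℕ → Fin m → ℝ := fun k => ∫ ω, u k ω ∂P
  ∫ ω, (x d.N ω ⬝ᵥ d.G *ᵥ x d.N ω + 2 * (d.g ω ⬝ᵥ x d.N ω)
    + Ex d.N ⬝ᵥ d.Gb *ᵥ Ex d.N + 2 * (d.gb ω ⬝ᵥ Ex d.N)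
    + ∑ k ∈ Finset.Ico l d.N,
        (x k ω ⬝ᵥ d.Q k *ᵥ x k ω + 2 * (u k ω ⬝ᵥ d.S k *ᵥ x k ω) + u k ω ⬝ᵥ d.R k *ᵥ u k ω
          + 2 * (d.q k ω ⬝ᵥ x k ω) + 2 * (d.ρ k ω ⬝ᵥ u k ω))
    + ∑ k ∈ Finset.Ico l d.N,
        (Ex k ⬝ᵥ d.Qb k *ᵥ Ex k + 2 * (Eu k ⬝ᵥ d.Sb k *ᵥ Ex k) + Eu k ⬝ᵥ d.Rb k *ᵥ Eu k
          + 2 * (d.qb k ω ⬝ᵥ Ex k) + 2 * (d.ρb k ω ⬝ᵥ Eu k))) ∂P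

/-! ### Closed-loop strategies -/

/-- A closed-loop strategy `(Θ, Θ̄, v)`; all three are deterministic. -/
structure Strategy (n m : ℕ) where
  Θ : ℕ → Matrix (Fin m) (Fin n) ℝ
  Θb : ℕ → Matrix (Fin m) (Fin n) ℝ
  v : ℕ → Fin m → ℝ

/-- The feedback law `x ↦ Θ_k x + Θ̄_k 𝔼x + v_k`. -/
def Strategy.feedback (s : Strategy n m) (P : Measure Ω) (k : ℕ) (x : Ω → Fin n → ℝ) :
    Ω → Fin m → ℝ := fun ω =>
  s.Θ k *ᵥ x ω + s.Θb k *ᵥ (∫ ω', x ω' ∂P) + s.v k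

/-- The closed-loop state process `x*` started at time `l` from `ξ`. -/
def Data.closedLoopState (d : Data Ω n m) (P : Measure Ω) (s : Strategy n m) (l : ℕ)
    (ξ : Ω → Fin n → ℝ) : ℕ → Ω → Fin n → ℝ
  | 0 => ξ
  | k + 1 => if k < l then ξ else
      d.step P k (d.closedLoopState P s l ξ k) (s.feedback P k (d.closedLoopState P s l ξ k))

/-- The control `Θ_k x*_k + Θ̄_k 𝔼x*_k + v_k` generated by a closed-loop strategy. -/
def Data.closedLoopControl (d : Data Ω n m) (P : Measure Ω) (s : Strategy n m) (l : ℕ)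
    (ξ : Ω → Fin n → ℝ) : ℕ → Ω → Fin m → ℝ :=
  fun k => s.feedback P k (d.closedLoopState P s l ξ k)

/-- `s` is a closed-loop optimal strategy on `{l, …, N-1}`: one strategy, independent of the
initial state, whose outcome is optimal for every initial state. -/
def Data.IsClosedLoopOptimal (d : Data Ω n m) (P : Measure Ω) (l : ℕ) (s : Strategy n m) : Prop :=
  ∀ ξ, d.IsInitialState P l ξ → ∀ u, d.Admissible P l ξ u →
    d.cost P l ξ (d.closedLoopControl P s l ξ) ≤ d.cost P l ξ u

/-- The problem is closed-loop solvable: a closed-loop optimal strategy exists on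
`{l, …, N-1}` for every initial time `l ∈ {0, …, N-1}`. -/
def Data.ClosedLoopSolvable (d : Data Ω n m) (P : Measure Ω) : Prop :=
  ∀ l < d.N, ∃ s : Strategy n m, d.IsClosedLoopOptimal P l s

end Problem

/-! ### The generalized Riccati equations -/

section Riccati

variable {Ω : Type*} {n m : ℕ}

/-- `Υ_k = R_k + B_k' P_{k+1} B_k + D_k' P_{k+1} D_k`. -/
def Data.Ups (d : Data Ω n m) (P : ℕ → Matrix (Fin n) (Fin n) ℝ) (k : ℕ) :
    Matrix (Fin m) (Fin m) ℝ :=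
  d.R k + (d.B k)ᵀ * P (k + 1) * d.B k + (d.D k)ᵀ * P (k + 1) * d.D k

/-- `Ῡ_k = R_k + R̄_k + (B_k + B̄_k)' Π_{k+1} (B_k + B̄_k) + (D_k + D̄_k)' P_{k+1} (D_k + D̄_k)`. -/
def Data.UpsBar (d : Data Ω n m) (P Pi : ℕ → Matrix (Fin n) (Fin n) ℝ) (k : ℕ) :
    Matrix (Fin m) (Fin m) ℝ :=
  d.R k + d.Rb k + (d.B k + d.Bb k)ᵀ * Pi (k + 1) * (d.B k + d.Bb k)
    + (d.D k + d.Db k)ᵀ * P (k + 1) * (d.D k + d.Db k)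

/-- `H_k = B_k' P_{k+1} A_k + D_k' P_{k+1} C_k + S_k`. -/
def Data.H (d : Data Ω n m) (P : ℕ → Matrix (Fin n) (Fin n) ℝ) (k : ℕ) :
    Matrix (Fin m) (Fin n) ℝ :=
  (d.B k)ᵀ * P (k + 1) * d.A k + (d.D k)ᵀ * P (k + 1) * d.C k + d.S k

/-- `H̄_k = (B_k + B̄_k)' Π_{k+1} (A_k + Ā_k) + (D_k + D̄_k)' P_{k+1} (C_k + C̄_k) + S_k + S̄_k`. -/
def Data.HBar (d : Data Ω n m) (P Pi : ℕ → Matrix (Fin n) (Fin n) ℝ) (k : ℕ) :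
    Matrix (Fin m) (Fin n) ℝ :=
  (d.B k + d.Bb k)ᵀ * Pi (k + 1) * (d.A k + d.Ab k)
    + (d.D k + d.Db k)ᵀ * P (k + 1) * (d.C k + d.Cb k) + d.S k + d.Sb k

/-- `(P, Π)` solves the generalized Riccati equations on `{0, …, N}`. -/
structure Data.IsGRESolution (d : Data Ω n m) (P Pi : ℕ → Matrix (Fin n) (Fin n) ℝ) : Prop where
  P_step : ∀ k < d.N, P k = d.Q k + (d.A k)ᵀ * P (k + 1) * d.A k + (d.C k)ᵀ * P (k + 1) * d.C k
    - (d.H P k)ᵀ * pinv (d.Ups P k) * d.H P k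
  Pi_step : ∀ k < d.N, Pi k = d.Q k + d.Qb k
    + (d.A k + d.Ab k)ᵀ * Pi (k + 1) * (d.A k + d.Ab k)
    + (d.C k + d.Cb k)ᵀ * P (k + 1) * (d.C k + d.Cb k)
    - (d.HBar P Pi k)ᵀ * pinv (d.UpsBar P Pi k) * d.HBar P Pi k
  P_final : P d.N = d.G
  Pi_final : Pi d.N = d.G + d.Gb

section L2

attribute [local instance] Matrix.frobeniusNormedAddCommGroup

/-- `K ∈ L²({0, …, N-1}; ℝ^{p×r})`, for the norm `|M|² = Tr(M'M)`. -/
def SquareIntegrableOn {p r : ℕ} (N : ℕ) (K : ℕ → Matrix (Fin p) (Fin r) ℝ) : Prop :=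
  MemLp (fun k : Fin N => K k) 2 (Measure.count : Measure (Fin N))

end L2

/-- A solution `(P, Π)` of the generalized Riccati equations is regular. -/
structure Data.IsRegular (d : Data Ω n m) (P Pi : ℕ → Matrix (Fin n) (Fin n) ℝ) : Prop where
  ups_nonneg : ∀ k < d.N, (d.Ups P k).PosSemidef
  upsBar_nonneg : ∀ k < d.N, (d.UpsBar P Pi k).PosSemidef
  range_le : ∀ k < d.N,
    LinearMap.range (d.H P k).mulVecLin ≤ LinearMap.range (d.Ups P k).mulVecLin
  range_bar_le : ∀ k < d.N,
    LinearMap.range (d.HBar P Pi k).mulVecLin ≤ LinearMap.range (d.UpsBar P Pi k).mulVecLin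
  gain_sq : SquareIntegrableOn d.N fun k => pinv (d.Ups P k) * d.H P k
  gain_bar_sq : SquareIntegrableOn d.N fun k => pinv (d.UpsBar P Pi k) * d.HBar P Pi k

/-- The generalized Riccati equations have a regular solution. -/
def Data.GRERegularlySolvable (d : Data Ω n m) : Prop :=
  ∃ P Pi : ℕ → Matrix (Fin n) (Fin n) ℝ, d.IsGRESolution P Pi ∧ d.IsRegular P Pi

end Riccati

end MFLQ

end

namespace MFLQ

/-! ### Linear algebra: pseudo-inverses and quadratic forms -/

/-! Since every matrix has a pseudo-inverse, the backward recursion always produces a solution of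
the Riccati equations (`Data.isGRESolution_riccati`). The content of the theorem is regularity,
which is extracted from optimality by backward induction on time.

Linear and inhomogeneous terms are removed at the outset (`Data.IsClosedLoopOptimal.homog`). Scale
the initial state by `t` and add `t` times a homogeneous control to the closed-loop control started
at zero. The cost is then a quadratic polynomial in `t` whose leading coefficient is the homogeneous
cost. Comparing optimal and competing controls at `t = 1` and `t = -1` cancels the linear terms. The
Riccati equations do not see the removed data.

For the homogeneous problem, one step splits into a cost of the fluctuation around the mean and a
cost of the mean (`Data.value_step_add_stageCost`), because the noise is centred with unit variance
given the available information. If regularity holds after time `l`, completing squares writes the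
cost-to-go from `l + 1` as a value plus nonnegative gaps, and the Riccati gains make all gaps vanish
(`Data.value_add_sum_gap`, `Data.gap_gainStrategy`). Hence an optimal strategy at `l` minimises the
one-step cost at `l` among all feedbacks (`Data.IsClosedLoopOptimal.oneStepCost_le`).

Two families of initial states then isolate the two quadratic forms
(`Data.IsClosedLoopOptimal.isRegularAt`). Constants see only the mean, and `η • c` with a nontrivial
centred scalar `η` sees the fluctuation. A quadratic function that has a minimiser has a nonnegative
Hessian and a solvable stationarity equation, which are the sign and range conditions. The
nonconstant initial state is what provides `η`. -/

theorem transpose_pinv {p r : ℕ} (M : Matrix (Fin p) (Fin r) ℝ) : (pinv M)ᵀ = pinv Mᵀ := by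
  have h := pinv_spec M
  refine IsPseudoInverse.unique (M := Mᵀ) ⟨?_, ?_, ?_, ?_⟩ (pinv_spec _)
  · rw [← transpose_mul, ← transpose_mul, ← Matrix.mul_assoc, h.mul_mul_self]
  · rw [← transpose_mul, ← transpose_mul, ← Matrix.mul_assoc, h.self_mul_mul]
  · rw [← transpose_mul, h.symm_right, h.symm_right]
  · rw [← transpose_mul, h.symm_left, h.symm_left]

/-- `U * pinv U` fixes the range of `U` pointwise, and that range contains every column of `H`. -/
theorem mul_pinv_mul_of_range_le {p r t : ℕ} (U : Matrix (Fin p) (Fin r) ℝ)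
    (H : Matrix (Fin p) (Fin t) ℝ)
    (h : LinearMap.range H.mulVecLin ≤ LinearMap.range U.mulVecLin) :
    U * (pinv U * H) = H := by
  refine Matrix.ext_of_mulVec_single fun i => ?_
  obtain ⟨z, hz⟩ := h ⟨Pi.single i 1, rfl⟩
  simp only [mulVecLin_apply] at hz
  rw [← mulVec_mulVec, ← mulVec_mulVec, ← hz, mulVec_mulVec, mulVec_mulVec,
    (pinv_spec U).mul_mul_self]

theorem mulVec_dotProduct_mulVec_mulVec {a b c e : ℕ} (A : Matrix (Fin c) (Fin a) ℝ)
    (M : Matrix (Fin c) (Fin e) ℝ) (B : Matrix (Fin e) (Fin b) ℝ) (x : Fin a → ℝ)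
    (y : Fin b → ℝ) : (A *ᵥ x) ⬝ᵥ M *ᵥ (B *ᵥ y) = x ⬝ᵥ (Aᵀ * M * B) *ᵥ y := by
  rw [dotProduct_comm, dotProduct_mulVec, ← mulVec_transpose, dotProduct_comm, mulVec_mulVec,
    mulVec_mulVec, Matrix.mul_assoc]

theorem dotProduct_mulVec_comm {a b : ℕ} (M : Matrix (Fin a) (Fin b) ℝ) (x : Fin a → ℝ)
    (y : Fin b → ℝ) : x ⬝ᵥ M *ᵥ y = y ⬝ᵥ Mᵀ *ᵥ x := by
  rw [dotProduct_mulVec, ← mulVec_transpose, dotProduct_comm]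

/-- The cost of one step with transition pairs `(A, B)` and `(C, D)`, terminal weights `P₁` and
`P₂` on the two successors, and stage weights `Q`, `S`, `R`. -/
def stageForm {n m : ℕ} (A : Matrix (Fin n) (Fin n) ℝ) (B : Matrix (Fin n) (Fin m) ℝ)
    (C : Matrix (Fin n) (Fin n) ℝ) (D : Matrix (Fin n) (Fin m) ℝ)
    (P₁ P₂ Q : Matrix (Fin n) (Fin n) ℝ) (S : Matrix (Fin m) (Fin n) ℝ)
    (R : Matrix (Fin m) (Fin m) ℝ) (x : Fin n → ℝ) (u : Fin m → ℝ) : ℝ :=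
  (A *ᵥ x + B *ᵥ u) ⬝ᵥ P₁ *ᵥ (A *ᵥ x + B *ᵥ u) + (C *ᵥ x + D *ᵥ u) ⬝ᵥ P₂ *ᵥ (C *ᵥ x + D *ᵥ u)
    + x ⬝ᵥ Q *ᵥ x + 2 * (u ⬝ᵥ S *ᵥ x) + u ⬝ᵥ R *ᵥ u

theorem stageForm_eq {n m : ℕ} (A : Matrix (Fin n) (Fin n) ℝ) (B : Matrix (Fin n) (Fin m) ℝ)
    (C : Matrix (Fin n) (Fin n) ℝ) (D : Matrix (Fin n) (Fin m) ℝ)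
    {P₁ P₂ : Matrix (Fin n) (Fin n) ℝ} (Q : Matrix (Fin n) (Fin n) ℝ)
    (S : Matrix (Fin m) (Fin n) ℝ) (R : Matrix (Fin m) (Fin m) ℝ)
    (h₁ : P₁ᵀ = P₁) (h₂ : P₂ᵀ = P₂) (x : Fin n → ℝ) (u : Fin m → ℝ) :
    stageForm A B C D P₁ P₂ Q S R x u =
      x ⬝ᵥ (Q + Aᵀ * P₁ * A + Cᵀ * P₂ * C) *ᵥ x
        + 2 * (u ⬝ᵥ (Bᵀ * P₁ * A + Dᵀ * P₂ * C + S) *ᵥ x)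
        + u ⬝ᵥ (R + Bᵀ * P₁ * B + Dᵀ * P₂ * D) *ᵥ u := by
  have e₁ : x ⬝ᵥ (Aᵀ * P₁ * B) *ᵥ u = u ⬝ᵥ (Bᵀ * P₁ * A) *ᵥ x := by
    rw [dotProduct_mulVec_comm]
    simp only [transpose_mul, transpose_transpose, h₁, Matrix.mul_assoc]
  have e₂ : x ⬝ᵥ (Cᵀ * P₂ * D) *ᵥ u = u ⬝ᵥ (Dᵀ * P₂ * C) *ᵥ x := by
    rw [dotProduct_mulVec_comm]
    simp only [transpose_mul, transpose_transpose, h₂, Matrix.mul_assoc]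
  simp only [stageForm, mulVec_add, add_dotProduct, dotProduct_add,
    mulVec_dotProduct_mulVec_mulVec, add_mulVec, e₁, e₂]
  ring

/-- Completion of the square. -/
theorem complete_square {n m : ℕ} (T : Matrix (Fin n) (Fin n) ℝ) (H : Matrix (Fin m) (Fin n) ℝ)
    {U : Matrix (Fin m) (Fin m) ℝ} (hU : Uᵀ = U)
    (h : LinearMap.range H.mulVecLin ≤ LinearMap.range U.mulVecLin)
    (x : Fin n → ℝ) (u : Fin m → ℝ) :
    x ⬝ᵥ T *ᵥ x + 2 * (u ⬝ᵥ H *ᵥ x) + u ⬝ᵥ U *ᵥ u =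
      x ⬝ᵥ (T - Hᵀ * pinv U * H) *ᵥ x
        + (u + (pinv U * H) *ᵥ x) ⬝ᵥ U *ᵥ (u + (pinv U * H) *ᵥ x) := by
  have hH := mul_pinv_mul_of_range_le U H h
  set K := pinv U * H with hK
  have hKt : Kᵀ = Hᵀ * pinv U := by rw [hK, transpose_mul, transpose_pinv, hU]
  have e₁ : (K *ᵥ x) ⬝ᵥ U *ᵥ u = u ⬝ᵥ H *ᵥ x := by
    rw [dotProduct_mulVec_comm, hU, mulVec_mulVec, hH]
  have e₂ : (K *ᵥ x) ⬝ᵥ H *ᵥ x = x ⬝ᵥ (Hᵀ * pinv U * H) *ᵥ x := by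
    simpa [hKt] using mulVec_dotProduct_mulVec_mulVec K H 1 x x
  simp only [mulVec_add, add_dotProduct, dotProduct_add, e₁, mulVec_mulVec, hH, sub_mulVec,
    dotProduct_sub, e₂]
  ring

theorem nonneg_of_forall_quadratic_nonneg {a b : ℝ} (h : ∀ t : ℝ, 0 ≤ t * b + t ^ 2 * a) :
    0 ≤ a ∧ b = 0 := by
  have ha : 0 ≤ a := by linarith [h 1, h (-1)]
  refine ⟨ha, ?_⟩
  -- Using `a + 1` instead of `a` in the near-minimiser treats `a = 0` and `a > 0` together; the
  -- value there is `-(b / (a + 1)) ^ 2`.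
  have h1 := h (-b / (a + 1))
  have h2 : -b / (a + 1) * b + (-b / (a + 1)) ^ 2 * a = -(b / (a + 1)) ^ 2 := by
    field_simp; ring
  rw [h2] at h1
  have h3 : b / (a + 1) = 0 := by nlinarith [sq_nonneg (b / (a + 1))]
  rcases div_eq_zero_iff.1 h3 with h4 | h4
  · exact h4
  · linarith

/-- A quadratic function with a minimiser has a nonnegative Hessian and a stationary point. -/
theorem posSemidef_of_forall_le {m : ℕ} {U : Matrix (Fin m) (Fin m) ℝ} (hU : Uᵀ = U)
    (h w₀ : Fin m → ℝ)
    (hmin : ∀ w, 2 * (w₀ ⬝ᵥ h) + w₀ ⬝ᵥ U *ᵥ w₀ ≤ 2 * (w ⬝ᵥ h) + w ⬝ᵥ U *ᵥ w) :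
    U.PosSemidef ∧ U *ᵥ (-w₀) = h := by
  have key : ∀ z, 0 ≤ z ⬝ᵥ U *ᵥ z ∧ 2 * (z ⬝ᵥ (h + U *ᵥ w₀)) = 0 := fun z =>
    nonneg_of_forall_quadratic_nonneg fun t => by
      have h1 := hmin (w₀ + t • z)
      have h2 : w₀ ⬝ᵥ U *ᵥ z = z ⬝ᵥ U *ᵥ w₀ := by rw [dotProduct_mulVec_comm, hU]
      simp only [mulVec_add, add_dotProduct, dotProduct_add, smul_dotProduct, dotProduct_smul,
        mulVec_smul, smul_eq_mul, h2] at h1 ⊢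
      linarith
  refine ⟨.of_dotProduct_mulVec_nonneg (by simpa [IsHermitian] using hU)
    fun z => by simpa using (key z).1, ?_⟩
  -- The gradient is orthogonal to every direction, in particular to itself.
  have h0 : h + U *ᵥ w₀ = 0 := dotProduct_self_eq_zero.1 (by linarith [(key (h + U *ᵥ w₀)).2])
  rw [mulVec_neg]
  exact (eq_neg_of_add_eq_zero_left h0).symm

/-! ### Noise that is conditionally centred with unit variance -/

section Noise

variable {Ω : Type*} {F F' : MeasurableSpace Ω} {mΩ : MeasurableSpace Ω} {P : Measure Ω}

theorem sup_eq_generateFrom_inter (m₁ m₂ : MeasurableSpace Ω) :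
    m₁ ⊔ m₂ = MeasurableSpace.generateFrom
      {S | ∃ s t, MeasurableSet[m₁] s ∧ MeasurableSet[m₂] t ∧ S = s ∩ t} := by
  refine le_antisymm (sup_le ?_ ?_) (MeasurableSpace.generateFrom_le ?_)
  · intro s hs
    exact MeasurableSpace.measurableSet_generateFrom
      ⟨s, Set.univ, hs, MeasurableSet.univ, (Set.inter_univ s).symm⟩
  · intro s hs
    exact MeasurableSpace.measurableSet_generateFrom
      ⟨Set.univ, s, MeasurableSet.univ, hs, (Set.univ_inter s).symm⟩
  · rintro _ ⟨s, t, hs, ht, rfl⟩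
    exact @MeasurableSet.inter _ (m₁ ⊔ m₂) _ _
      (le_sup_left (a := m₁) (b := m₂) s hs) (le_sup_right (a := m₁) (b := m₂) t ht)

theorem isPiSystem_inter (m₁ m₂ : MeasurableSpace Ω) :
    IsPiSystem {S | ∃ s t, MeasurableSet[m₁] s ∧ MeasurableSet[m₂] t ∧ S = s ∩ t} := by
  rintro _ ⟨s, t, hs, ht, rfl⟩ _ ⟨s', t', hs', ht', rfl⟩ -
  exact ⟨s ∩ s', t ∩ t', @MeasurableSet.inter _ m₁ _ _ hs hs',
    @MeasurableSet.inter _ m₂ _ _ ht ht', Set.inter_inter_inter_comm s t s' t'⟩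

/-- Enlarging the conditioning field by an independent field does not change a constant
conditional expectation. -/
theorem condExp_sup_ae_eq_const [IsProbabilityMeasure P] {m₁ m₂ m₃ : MeasurableSpace Ω}
    (h₁ : m₁ ≤ mΩ) (h₃ : m₃ ≤ mΩ) (h₂₃ : m₂ ≤ m₃) (hind : Indep m₁ m₃ P) {Z : Ω → ℝ}
    (hZ : StronglyMeasurable[m₃] Z) (hZi : Integrable Z P) {c : ℝ}
    (hc : P[Z | m₂] =ᵐ[P] fun _ => c) : P[Z | m₁ ⊔ m₂] =ᵐ[P] fun _ => c := by
  have h₂ : m₂ ≤ mΩ := h₂₃.trans h₃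
  have h₁₂ : m₁ ⊔ m₂ ≤ mΩ := sup_le h₁ h₂
  have hint : ∀ t, MeasurableSet[m₂] t → ∫ ω in t, Z ω ∂P = P.real t * c := by
    intro t ht
    rw [← setIntegral_condExp h₂ hZi ht,
      setIntegral_congr_ae (h₂ t ht) (hc.mono fun _ h _ => h)]
    simp
  have key : ∀ S, MeasurableSet[m₁ ⊔ m₂] S → ∫ ω in S, Z ω ∂P = P.real S * c := by
    intro S hS
    induction S, hS using MeasurableSpace.induction_on_inter
      (sup_eq_generateFrom_inter m₁ m₂) (isPiSystem_inter m₁ m₂) with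
    | empty => simp
    | basic S hS =>
      obtain ⟨s, t, hs, ht, rfl⟩ := hS
      -- On a rectangle `s ∩ t` the factor `t` is absorbed into `Z`; the product stays
      -- `m₃`-measurable, so independence from `m₁` separates off `s`.
      have hf : StronglyMeasurable[m₃] (t.indicator Z) := hZ.indicator (h₂₃ t ht)
      have hfi : Integrable (t.indicator Z) P := hZi.indicator (h₂ t ht)
      have e := condExp_indep_eq h₃ h₁ hf hind.symm
      rw [← setIntegral_indicator (h₂ t ht), ← setIntegral_condExp h₁ hfi hs,
        setIntegral_congr_ae (h₁ s hs) (e.mono fun _ h _ => h), setIntegral_const,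
        integral_indicator (h₂ t ht), hint t ht, measureReal_def, measureReal_def, measureReal_def,
        (Indep_iff m₁ m₃ P).1 hind s t hs (h₂₃ t ht), ENNReal.toReal_mul, smul_eq_mul, mul_assoc]
    | compl S hS ih =>
      rw [setIntegral_compl (h₁₂ S hS) hZi, ih, measureReal_compl (h₁₂ S hS),
        ← setIntegral_univ, hint _ MeasurableSet.univ]
      simp only [probReal_univ]
      ring
    | iUnion f hd hm ih =>
      have e₁ := hasSum_integral_iUnion (μ := P) (fun i => h₁₂ _ (hm i)) hd hZi.integrableOn
      have e₂ := hasSum_integral_iUnion (μ := P) (f := fun _ => c) (fun i => h₁₂ _ (hm i)) hd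
        (integrable_const c).integrableOn
      simp only [ih] at e₁
      simp only [setIntegral_const, smul_eq_mul] at e₂
      exact e₁.unique e₂
  refine (ae_eq_condExp_of_forall_setIntegral_eq h₁₂ hZi
    (fun s _ _ => (integrable_const c).integrableOn) (fun s hs _ => ?_)
    aestronglyMeasurable_const).symm
  rw [key s hs, setIntegral_const, smul_eq_mul]

/-- `w` is square integrable, and conditionally on `F` it is centred with unit variance. -/
structure IsUnitNoise (P : Measure Ω) (F : MeasurableSpace Ω) (w : Ω → ℝ) : Prop where
  le : F ≤ mΩ
  measurable : Measurable[mΩ] w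
  memLp : MemLp w 2 P
  condExp : P[w | F] =ᵐ[P] fun _ => 0
  condExp_sq : P[fun ω => w ω ^ 2 | F] =ᵐ[P] fun _ => 1

namespace IsUnitNoise

variable [IsProbabilityMeasure P] {w : Ω → ℝ}

/-- Unit conditional variance says that the measure with density `w ^ 2` agrees with `P` on `F`.
Working with lower integrals needs no integrability, so this yields the integrability of `w ^ 2 * f`
that pulling `f` out of a conditional expectation requires. -/
theorem lintegral_mul_sq (h : IsUnitNoise P F w) {f : Ω → ENNReal} (hf : Measurable[F] f) :
    ∫⁻ ω, ENNReal.ofReal (w ω ^ 2) * f ω ∂P = ∫⁻ ω, f ω ∂P := by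
  have hw : Measurable fun ω => ENNReal.ofReal (w ω ^ 2) :=
    (h.measurable.pow_const 2).ennreal_ofReal
  have hwi : Integrable (fun ω => w ω ^ 2) P := h.memLp.integrable_sq
  have e : (P.withDensity fun ω => ENNReal.ofReal (w ω ^ 2)).trim h.le = P.trim h.le := by
    refine @Measure.ext _ F _ _ fun s hs => ?_
    rw [trim_measurableSet_eq _ hs, trim_measurableSet_eq _ hs, withDensity_apply _ (h.le s hs),
      ← ofReal_integral_eq_lintegral_ofReal hwi.integrableOn (ae_of_all _ fun _ => sq_nonneg _),
      ← setIntegral_condExp h.le hwi hs,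
      setIntegral_congr_ae (h.le s hs) (h.condExp_sq.mono fun _ h _ => h)]
    simp
  have e₂ := lintegral_withDensity_eq_lintegral_mul P hw (hf.mono h.le le_rfl)
  simp only [Pi.mul_apply] at e₂
  rw [← e₂, ← lintegral_trim h.le hf, e, lintegral_trim h.le hf]

theorem integrable_sq_mul (h : IsUnitNoise P F w) {f : Ω → ℝ} (hf : Measurable[F] f)
    (hfi : Integrable f P) : Integrable (fun ω => w ω ^ 2 * f ω) P := by
  refine ⟨((h.measurable.pow_const 2).mul (hf.mono h.le le_rfl)).aestronglyMeasurable, ?_⟩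
  have hfe : Measurable[F] fun ω => ‖f ω‖ₑ := measurable_enorm.comp hf
  have e := h.lintegral_mul_sq hfe
  rw [hasFiniteIntegral_iff_enorm]
  calc ∫⁻ ω, ‖w ω ^ 2 * f ω‖ₑ ∂P = ∫⁻ ω, ENNReal.ofReal (w ω ^ 2) * ‖f ω‖ₑ ∂P := by
        refine lintegral_congr fun ω => ?_
        rw [enorm_mul, Real.enorm_eq_ofReal (sq_nonneg _)]
    _ < ⊤ := by rw [e]; exact hfi.2

theorem integrable_mul (h : IsUnitNoise P F w) {f : Ω → ℝ} (hf : Measurable[F] f)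
    (hfi : Integrable f P) : Integrable (fun ω => w ω * f ω) P := by
  -- Since `f` is only assumed integrable, Cauchy-Schwarz is replaced by the bound `|w| ≤ 1 + w ^
  -- 2`.
  refine (hfi.norm.add (h.integrable_sq_mul hf hfi).norm).mono'
    ((h.measurable.mul (hf.mono h.le le_rfl)).aestronglyMeasurable) (ae_of_all _ fun ω => ?_)
  simp only [Pi.add_apply, norm_mul, norm_pow]
  nlinarith [norm_nonneg (f ω), sq_nonneg (‖w ω‖ - 1), sq_nonneg (‖w ω‖),
    mul_nonneg (norm_nonneg (f ω)) (sq_nonneg (‖w ω‖ - 1)),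
    mul_nonneg (norm_nonneg (f ω)) (sq_nonneg (‖w ω‖))]

theorem integral_mul (h : IsUnitNoise P F w) {f : Ω → ℝ} (hf : Measurable[F] f)
    (hfi : Integrable f P) : ∫ ω, w ω * f ω ∂P = 0 := by
  have e := condExp_mul_of_stronglyMeasurable_right (μ := P) hf.stronglyMeasurable
    (h.integrable_mul hf hfi) (h.memLp.integrable one_le_two)
  rw [← integral_condExp h.le, show P[fun ω => w ω * f ω | F] = P[w * f | F] from rfl,
    integral_congr_ae e]
  refine integral_eq_zero_of_ae (h.condExp.mono fun ω hω => ?_)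
  simp [hω]

theorem integral_sq_mul (h : IsUnitNoise P F w) {f : Ω → ℝ} (hf : Measurable[F] f)
    (hfi : Integrable f P) : ∫ ω, w ω ^ 2 * f ω ∂P = ∫ ω, f ω ∂P := by
  have e := condExp_mul_of_stronglyMeasurable_right (μ := P) hf.stronglyMeasurable
    (h.integrable_sq_mul hf hfi) h.memLp.integrable_sq
  rw [← integral_condExp h.le,
    show P[fun ω => w ω ^ 2 * f ω | F] = P[(fun ω => w ω ^ 2) * f | F] from rfl,
    integral_congr_ae e]
  refine integral_congr_ae (h.condExp_sq.mono fun ω hω => ?_)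
  simp [hω]

theorem memLp_mul (h : IsUnitNoise P F w) {f : Ω → ℝ} (hf : Measurable[F] f)
    (hfi : MemLp f 2 P) : MemLp (fun ω => w ω * f ω) 2 P := by
  have hm : AEStronglyMeasurable (fun ω => w ω * f ω) P :=
    (h.measurable.mul (hf.mono h.le le_rfl)).aestronglyMeasurable
  rw [memLp_two_iff_integrable_sq hm]
  simpa only [mul_pow] using h.integrable_sq_mul (hf.pow_const 2) hfi.integrable_sq

end IsUnitNoise

/-! ### Square integrable random vectors -/

variable {n m : ℕ}

/-- An `F`-measurable, square integrable random vector. -/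
def IsL2 (P : Measure Ω) (F : MeasurableSpace Ω) (x : Ω → Fin n → ℝ) : Prop :=
  Measurable[F] x ∧ MemLp x 2 P

theorem measurable_mulVec {x : Ω → Fin n → ℝ} (hx : Measurable[F] x)
    (M : Matrix (Fin m) (Fin n) ℝ) : Measurable[F] fun ω => M *ᵥ x ω :=
  (Continuous.matrix_mulVec continuous_const continuous_id).measurable.comp hx

theorem memLp_mulVec {x : Ω → Fin n → ℝ} (hx : MemLp x 2 P) (M : Matrix (Fin m) (Fin n) ℝ) :
    MemLp (fun ω => M *ᵥ x ω) 2 P :=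
  hx.continuousLinearMap_comp (LinearMap.toContinuousLinearMap M.mulVecLin)

theorem integral_mulVec {x : Ω → Fin n → ℝ} (hx : Integrable x P)
    (M : Matrix (Fin m) (Fin n) ℝ) : ∫ ω, M *ᵥ x ω ∂P = M *ᵥ ∫ ω, x ω ∂P :=
  (LinearMap.toContinuousLinearMap M.mulVecLin).integral_comp_comm hx

theorem integrable_dotProduct {x y : Ω → Fin n → ℝ} (hx : MemLp x 2 P) (hy : MemLp y 2 P) :
    Integrable (fun ω => x ω ⬝ᵥ y ω) P :=
  integrable_finsetSum _ fun i _ => (hx.eval i).integrable_mul (hy.eval i)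

theorem integrable_dotProduct_mulVec {x : Ω → Fin n → ℝ} {y : Ω → Fin m → ℝ} (hx : MemLp x 2 P)
    (hy : MemLp y 2 P) (M : Matrix (Fin n) (Fin m) ℝ) :
    Integrable (fun ω => x ω ⬝ᵥ M *ᵥ y ω) P :=
  integrable_dotProduct hx (memLp_mulVec hy M)

theorem integral_dotProduct_const {x : Ω → Fin n → ℝ} (hx : Integrable x P) (c : Fin n → ℝ) :
    ∫ ω, x ω ⬝ᵥ c ∂P = (∫ ω, x ω ∂P) ⬝ᵥ c := by
  simp only [dotProduct]
  rw [integral_finsetSum _ fun i _ => (hx.eval i).mul_const _]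
  simp_rw [integral_mul_const, eval_integral (fun i => hx.eval i)]

theorem measurable_dotProduct {x y : Ω → Fin n → ℝ}
    (hx : Measurable[F] x) (hy : Measurable[F] y) : Measurable[F] fun ω => x ω ⬝ᵥ y ω :=
  Finset.measurable_fun_sum _ fun i _ =>
    ((measurable_pi_apply i).comp hx).mul ((measurable_pi_apply i).comp hy)

/-- The covariance decomposition of a bilinear expectation. -/
theorem integral_dotProduct_mulVec [IsProbabilityMeasure P] {x : Ω → Fin n → ℝ}
    {y : Ω → Fin m → ℝ} (hx : MemLp x 2 P) (hy : MemLp y 2 P) (M : Matrix (Fin n) (Fin m) ℝ) :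
    ∫ ω, x ω ⬝ᵥ M *ᵥ y ω ∂P =
      ∫ ω, (x ω - ∫ ω', x ω' ∂P) ⬝ᵥ M *ᵥ (y ω - ∫ ω', y ω' ∂P) ∂P
        + (∫ ω, x ω ∂P) ⬝ᵥ M *ᵥ ∫ ω, y ω ∂P := by
  have hxi := hx.integrable one_le_two
  have hyi := hy.integrable one_le_two
  set a := ∫ ω, x ω ∂P with ha
  set b := ∫ ω, y ω ∂P with hb
  have i₀ : Integrable (fun ω => (x ω - a) ⬝ᵥ M *ᵥ (y ω - b)) P :=
    integrable_dotProduct_mulVec (hx.sub (memLp_const a)) (hy.sub (memLp_const b)) M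
  have i₁ : Integrable (fun ω => x ω ⬝ᵥ M *ᵥ b) P :=
    integrable_dotProduct hx (memLp_const _)
  have i₂ : Integrable (fun ω => y ω ⬝ᵥ Mᵀ *ᵥ a) P :=
    integrable_dotProduct hy (memLp_const _)
  have e : ∀ ω, x ω ⬝ᵥ M *ᵥ y ω = (x ω - a) ⬝ᵥ M *ᵥ (y ω - b)
      + (x ω ⬝ᵥ M *ᵥ b + y ω ⬝ᵥ Mᵀ *ᵥ a - a ⬝ᵥ M *ᵥ b) := by
    intro ω
    rw [← dotProduct_mulVec_comm M a (y ω)]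
    simp only [mulVec_sub, sub_dotProduct, dotProduct_sub]
    ring
  have i₃ : Integrable (fun ω => x ω ⬝ᵥ M *ᵥ b + y ω ⬝ᵥ Mᵀ *ᵥ a) P := i₁.add i₂
  have i₄ : Integrable (fun ω => x ω ⬝ᵥ M *ᵥ b + y ω ⬝ᵥ Mᵀ *ᵥ a - a ⬝ᵥ M *ᵥ b) P :=
    i₃.sub (integrable_const _)
  simp only [e]
  rw [integral_add i₀ i₄, integral_sub i₃ (integrable_const _), integral_add i₁ i₂,
    integral_dotProduct_const hxi, integral_dotProduct_const hyi, ← hb, ← ha,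
    ← dotProduct_mulVec_comm M a b]
  simp only [integral_const, probReal_univ, one_smul]
  ring

namespace IsL2

variable {x y : Ω → Fin n → ℝ}

theorem mono (hx : IsL2 P F x) (h : F ≤ F') : IsL2 P F' x :=
  ⟨hx.1.mono h le_rfl, hx.2⟩

theorem add (hx : IsL2 P F x) (hy : IsL2 P F y) : IsL2 P F fun ω => x ω + y ω :=
  ⟨hx.1.add hy.1, hx.2.add hy.2⟩

theorem mulVec (hx : IsL2 P F x) (M : Matrix (Fin m) (Fin n) ℝ) :
    IsL2 P F fun ω => M *ᵥ x ω :=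
  ⟨measurable_mulVec hx.1 M, memLp_mulVec hx.2 M⟩

theorem integrable (hx : IsL2 P F x) [IsProbabilityMeasure P] : Integrable x P :=
  hx.2.integrable one_le_two

theorem smul_noise [IsProbabilityMeasure P] {w : Ω → ℝ} (hw : IsUnitNoise P F w)
    (hx : IsL2 P F x) : MemLp (fun ω => w ω • x ω) 2 P :=
  memLp_pi_iff.2 fun i => hw.memLp_mul ((measurable_pi_apply i).comp hx.1) (hx.2.eval i)

theorem integral_smul_noise [IsProbabilityMeasure P] {w : Ω → ℝ} (hw : IsUnitNoise P F w)
    (hx : IsL2 P F x) : ∫ ω, w ω • x ω ∂P = 0 := by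
  ext i
  rw [eval_integral (fun i => ((smul_noise hw hx).integrable one_le_two).eval i)]
  exact hw.integral_mul ((measurable_pi_apply i).comp hx.1) ((hx.2.eval i).integrable one_le_two)

end IsL2

theorem isL2_const [IsProbabilityMeasure P] (F : MeasurableSpace Ω) (c : Fin n → ℝ) :
    IsL2 P F fun _ => c :=
  ⟨measurable_const, memLp_const c⟩

/-- The second moment of drift plus noise. -/
theorem integral_drift_add_noise [IsProbabilityMeasure P] {w : Ω → ℝ}
    (hw : IsUnitNoise P F w) {a c : Ω → Fin n → ℝ} (ha : IsL2 P F a) (hc : IsL2 P F c)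
    (M : Matrix (Fin n) (Fin n) ℝ) :
    ∫ ω, (a ω + w ω • c ω) ⬝ᵥ M *ᵥ (a ω + w ω • c ω) ∂P =
      ∫ ω, a ω ⬝ᵥ M *ᵥ a ω ∂P + ∫ ω, c ω ⬝ᵥ M *ᵥ c ω ∂P := by
  have maa := integrable_dotProduct_mulVec ha.2 ha.2 M
  have mcc := integrable_dotProduct_mulVec hc.2 hc.2 M
  have mac : Integrable (fun ω => a ω ⬝ᵥ M *ᵥ c ω + c ω ⬝ᵥ M *ᵥ a ω) P :=
    (integrable_dotProduct_mulVec ha.2 hc.2 M).add (integrable_dotProduct_mulVec hc.2 ha.2 M)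
  have fcc : Measurable[F] fun ω => c ω ⬝ᵥ M *ᵥ c ω :=
    measurable_dotProduct hc.1 (measurable_mulVec hc.1 M)
  have fac : Measurable[F] fun ω => a ω ⬝ᵥ M *ᵥ c ω + c ω ⬝ᵥ M *ᵥ a ω :=
    (measurable_dotProduct ha.1 (measurable_mulVec hc.1 M)).add
      (measurable_dotProduct hc.1 (measurable_mulVec ha.1 M))
  have e : ∀ ω, (a ω + w ω • c ω) ⬝ᵥ M *ᵥ (a ω + w ω • c ω) = a ω ⬝ᵥ M *ᵥ a ω
      + (w ω * (a ω ⬝ᵥ M *ᵥ c ω + c ω ⬝ᵥ M *ᵥ a ω) + w ω ^ 2 * (c ω ⬝ᵥ M *ᵥ c ω)) := by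
    intro ω
    simp only [mulVec_add, mulVec_smul, add_dotProduct, dotProduct_add, smul_dotProduct,
      dotProduct_smul, smul_eq_mul]
    ring
  have i₁ : Integrable (fun ω => w ω * (a ω ⬝ᵥ M *ᵥ c ω + c ω ⬝ᵥ M *ᵥ a ω)
      + w ω ^ 2 * (c ω ⬝ᵥ M *ᵥ c ω)) P :=
    (hw.integrable_mul fac mac).add (hw.integrable_sq_mul fcc mcc)
  simp only [e]
  rw [integral_add maa i₁, integral_add (hw.integrable_mul fac mac) (hw.integrable_sq_mul fcc mcc),
    hw.integral_mul fac mac, hw.integral_sq_mul fcc mcc, zero_add]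

end Noise

section StateProcess

variable {Ω : Type*} {n m : ℕ} {F F' : MeasurableSpace Ω} {mΩ : MeasurableSpace Ω}
  {P : Measure Ω} {d : Data Ω n m} {l k : ℕ} {ξ : Ω → Fin n → ℝ} {u : ℕ → Ω → Fin m → ℝ}

/-! ### Information fields -/

theorem Data.noiseField_mono (d : Data Ω n m) {l l' k k' : ℕ} (hl : l' ≤ l) (hk : k ≤ k') :
    d.noiseField l k ≤ d.noiseField l' k' :=
  biSup_mono fun _ hj => ⟨hl.trans hj.1, hj.2.trans_le hk⟩

theorem Data.infoField_mono (d : Data Ω n m) (ξ : Ω → Fin n → ℝ) (l : ℕ) {k k' : ℕ}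
    (hk : k ≤ k') : d.infoField ξ l k ≤ d.infoField ξ l k' :=
  sup_le_sup_left (d.noiseField_mono le_rfl hk) _

theorem Data.comap_le_noiseField (d : Data Ω n m) {l k j : ℕ} (hl : l ≤ j) (hk : j < k) :
    MeasurableSpace.comap (d.w j) inferInstance ≤ d.noiseField l k :=
  le_biSup (fun j => MeasurableSpace.comap (d.w j) inferInstance)
    (show j ∈ Set.Ico l k from ⟨hl, hk⟩)

theorem Data.measurable_noise_infoField (d : Data Ω n m) (ξ : Ω → Fin n → ℝ) (hlk : l ≤ k) :
    Measurable[d.infoField ξ l (k + 1)] (d.w k) :=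
  measurable_iff_comap_le.2
    ((d.comap_le_noiseField hlk (Nat.lt_succ_self k)).trans le_sup_right)

theorem Data.IsMartingaleDifference.noiseField_le (h : d.IsMartingaleDifference P)
    (hk : k ≤ d.N) : d.noiseField l k ≤ mΩ :=
  iSup₂_le fun j hj => (h.measurable j (hj.2.trans_le hk)).comap_le

theorem Data.IsInitialState.infoField_le (hξ : d.IsInitialState P l ξ)
    (h : d.IsMartingaleDifference P) (hk : k ≤ d.N) : d.infoField ξ l k ≤ mΩ :=
  sup_le hξ.measurable.comap_le (h.noiseField_le hk)

/-- Seen from an initial state at time `l`, the later noise is still a martingale difference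
with unit conditional variance. -/
theorem Data.IsInitialState.isUnitNoise [IsProbabilityMeasure P] (hξ : d.IsInitialState P l ξ)
    (h : d.IsMartingaleDifference P) (hlk : l ≤ k) (hk : k < d.N) :
    IsUnitNoise P (d.infoField ξ l k) (d.w k) := by
  have hw : Measurable[d.noiseField l d.N] (d.w k) :=
    measurable_iff_comap_le.2 (d.comap_le_noiseField hlk hk)
  -- The hypotheses condition on the noise from time `0`. The tower property passes to the noise
  -- from time `l`, and `ξ` is then adjoined by independence.
  have tower : ∀ {Z : Ω → ℝ} {c : ℝ}, P[Z | d.noiseField 0 k] =ᵐ[P] (fun _ => c) →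
      P[Z | d.noiseField l k] =ᵐ[P] fun _ => c := fun {Z c} hZ => by
    have e := condExp_condExp_of_le (μ := P) (f := Z) (d.noiseField_mono (Nat.zero_le l) le_rfl)
      (h.noiseField_le (l := 0) hk.le)
    refine e.symm.trans ((condExp_congr_ae hZ).trans ?_)
    rw [condExp_const (h.noiseField_le hk.le)]
  refine ⟨hξ.infoField_le h hk.le, h.measurable k hk, h.memLp k hk, ?_, ?_⟩
  · exact condExp_sup_ae_eq_const hξ.measurable.comap_le (h.noiseField_le le_rfl)
      (d.noiseField_mono le_rfl hk.le) hξ.indep hw.stronglyMeasurable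
      ((h.memLp k hk).integrable one_le_two) (tower (h.condExp_eq_zero k hk))
  · exact condExp_sup_ae_eq_const hξ.measurable.comap_le (h.noiseField_le le_rfl)
      (d.noiseField_mono le_rfl hk.le) hξ.indep (hw.pow_const 2).stronglyMeasurable
      (h.memLp k hk).integrable_sq (tower (h.condExp_sq_eq_one k hk))

/-- A constant generates the trivial field, which is independent of everything. These states probe
the mean, and the zero state is the base point of the homogenisation. -/
theorem Data.isInitialState_const [IsProbabilityMeasure P] (d : Data Ω n m) (l : ℕ)
    (c : Fin n → ℝ) : d.IsInitialState P l fun _ => c := by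
  refine ⟨measurable_const, memLp_const c, ?_⟩
  rw [MeasurableSpace.comap_const]
  exact indep_bot_left _

/-- Independence passes to functions of `ξ` and to the smaller field of later noise. This carries an
initial state at time `0` to every later time. -/
theorem Data.IsInitialState.of_comap_le {l' : ℕ} (hξ : d.IsInitialState P l ξ) (hl : l ≤ l')
    {ζ : Ω → Fin n → ℝ} (hζ : MemLp ζ 2 P)
    (hle : MeasurableSpace.comap ζ inferInstance ≤ MeasurableSpace.comap ξ inferInstance) :
    d.IsInitialState P l' ζ :=
  ⟨(measurable_iff_comap_le.2 hle).mono hξ.measurable.comap_le le_rfl, hζ,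
    indep_of_indep_of_le_left (indep_of_indep_of_le_right hξ.indep (d.noiseField_mono hl le_rfl))
      hle⟩

theorem comap_smul_le (t : ℝ) (ξ : Ω → Fin n → ℝ) :
    MeasurableSpace.comap (fun ω => t • ξ ω) inferInstance
      ≤ MeasurableSpace.comap ξ inferInstance :=
  measurable_iff_comap_le.1 ((comap_measurable ξ).const_smul t)

/-! ### State processes -/

/-- The drift part of one step of the system. -/
noncomputable def Data.drift (d : Data Ω n m) (P : Measure Ω) (k : ℕ) (x : Ω → Fin n → ℝ)
    (u : Ω → Fin m → ℝ) : Ω → Fin n → ℝ := fun ω =>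
  d.A k *ᵥ x ω + d.Ab k *ᵥ (∫ ω', x ω' ∂P) + d.B k *ᵥ u ω + d.Bb k *ᵥ (∫ ω', u ω' ∂P) + d.b k

/-- The diffusion part of one step of the system. -/
noncomputable def Data.diffusion (d : Data Ω n m) (P : Measure Ω) (k : ℕ) (x : Ω → Fin n → ℝ)
    (u : Ω → Fin m → ℝ) : Ω → Fin n → ℝ := fun ω =>
  d.C k *ᵥ x ω + d.Cb k *ᵥ (∫ ω', x ω' ∂P) + d.D k *ᵥ u ω + d.Db k *ᵥ (∫ ω', u ω' ∂P) + d.σ k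

theorem Data.state_of_le (d : Data Ω n m) (ξ : Ω → Fin n → ℝ) (u : ℕ → Ω → Fin m → ℝ)
    (h : k ≤ l) : d.state P l ξ u k = ξ := by
  cases k with
  | zero => rfl
  | succ k => rw [Data.state, if_pos (Nat.lt_of_succ_le h)]

theorem Data.state_succ (d : Data Ω n m) (ξ : Ω → Fin n → ℝ) (u : ℕ → Ω → Fin m → ℝ)
    (h : l ≤ k) : d.state P l ξ u (k + 1) = d.step P k (d.state P l ξ u k) (u k) := by
  rw [Data.state, if_neg (not_lt.2 h)]

theorem Data.state_closedLoopControl (d : Data Ω n m) (s : Strategy n m) (l : ℕ)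
    (ξ : Ω → Fin n → ℝ) (k : ℕ) :
    d.state P l ξ (d.closedLoopControl P s l ξ) k = d.closedLoopState P s l ξ k := by
  induction k with
  | zero => rfl
  | succ k ih => rw [Data.state, Data.closedLoopState, ih]; rfl

variable [IsProbabilityMeasure P]

theorem isL2_affine {n' : ℕ} {x : Ω → Fin n → ℝ} {u : Ω → Fin m → ℝ}
    (hx : IsL2 P F x) (hu : IsL2 P F u) (A : Matrix (Fin n') (Fin n) ℝ)
    (B : Matrix (Fin n') (Fin m) ℝ) (a b c : Fin n' → ℝ) :
    IsL2 P F fun ω => A *ᵥ x ω + a + B *ᵥ u ω + b + c :=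
  ((((hx.mulVec A).add (isL2_const F a)).add (hu.mulVec B)).add (isL2_const F b)).add
    (isL2_const F c)

theorem Data.isL2_step (hF : F ≤ F') (hw : IsUnitNoise P F (d.w k))
    (hw' : Measurable[F'] (d.w k)) {x : Ω → Fin n → ℝ} {u : Ω → Fin m → ℝ} (hx : IsL2 P F x)
    (hu : IsL2 P F u) : IsL2 P F' (d.step P k x u) := by
  have h₁ : IsL2 P F (d.drift P k x u) := isL2_affine hx hu _ _ _ _ _
  have h₂ : IsL2 P F (d.diffusion P k x u) := isL2_affine hx hu _ _ _ _ _
  exact ⟨(h₁.1.mono hF le_rfl).add (hw'.smul (h₂.1.mono hF le_rfl)),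
    h₁.2.add (IsL2.smul_noise hw h₂)⟩

/-- The state is adapted and square integrable as soon as the control inherits these properties
from the state. -/
theorem Data.IsInitialState.isL2_state (hξ : d.IsInitialState P l ξ)
    (h : d.IsMartingaleDifference P)
    (hu : ∀ k, l ≤ k → k < d.N → IsL2 P (d.infoField ξ l k) (d.state P l ξ u k) →
      IsL2 P (d.infoField ξ l k) (u k)) (hlk : l ≤ k) (hk : k ≤ d.N) :
    IsL2 P (d.infoField ξ l k) (d.state P l ξ u k) := by
  induction k, hlk using Nat.le_induction with
  | base =>
    rw [d.state_of_le _ _ le_rfl]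
    exact ⟨(comap_measurable ξ).mono le_sup_left le_rfl, hξ.memLp⟩
  | succ k hlk ih =>
    rw [d.state_succ _ _ hlk]
    exact Data.isL2_step (d.infoField_mono ξ l k.le_succ) (hξ.isUnitNoise h hlk hk)
      (d.measurable_noise_infoField ξ hlk) (ih (Nat.le_of_succ_le hk))
      (hu k hlk hk (ih (Nat.le_of_succ_le hk)))

theorem Data.IsInitialState.isL2_state_of_admissible (hξ : d.IsInitialState P l ξ)
    (h : d.IsMartingaleDifference P) (hu : d.Admissible P l ξ u) (hlk : l ≤ k) (hk : k ≤ d.N) :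
    IsL2 P (d.infoField ξ l k) (d.state P l ξ u k) :=
  hξ.isL2_state h (fun k h₁ h₂ _ => hu k h₁ h₂) hlk hk

theorem Strategy.isL2_feedback (s : Strategy n m) (k : ℕ)
    {x : Ω → Fin n → ℝ} (hx : IsL2 P F x) : IsL2 P F (s.feedback P k x) :=
  ((hx.mulVec _).add (isL2_const F _)).add (isL2_const F _)

/-- State and control depend on each other here. The circle is broken because the feedback at time
`k` uses only the state at time `k`, which is the form of hypothesis that `isL2_state` accepts. -/
theorem Data.IsInitialState.admissible_closedLoopControl (hξ : d.IsInitialState P l ξ)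
    (h : d.IsMartingaleDifference P) (s : Strategy n m) :
    d.Admissible P l ξ (d.closedLoopControl P s l ξ) := by
  have key : ∀ k, IsL2 P (d.infoField ξ l k)
      (d.state P l ξ (d.closedLoopControl P s l ξ) k) →
      IsL2 P (d.infoField ξ l k) (d.closedLoopControl P s l ξ k) := by
    intro k hx
    rw [d.state_closedLoopControl] at hx
    exact s.isL2_feedback k hx
  exact fun k h₁ h₂ => key k (hξ.isL2_state h (fun k _ _ => key k) h₁ h₂.le)


end StateProcess

/-! ### Functions of a real parameter that are quadratic polynomials -/

/-- `f t = t² a + t b + c` for some `b`. -/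
def IsQuadratic (f : ℝ → ℝ) (a c : ℝ) : Prop :=
  ∃ b, ∀ t, f t = t ^ 2 * a + t * b + c

namespace IsQuadratic

theorem add {f g : ℝ → ℝ} {a c a' c' : ℝ} (hf : IsQuadratic f a c) (hg : IsQuadratic g a' c') :
    IsQuadratic (fun t => f t + g t) (a + a') (c + c') := by
  obtain ⟨b, hb⟩ := hf
  obtain ⟨b', hb'⟩ := hg
  exact ⟨b + b', fun t => by simp only [hb, hb']; ring⟩

theorem const_mul {f : ℝ → ℝ} {a c : ℝ} (r : ℝ) (hf : IsQuadratic f a c) :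
    IsQuadratic (fun t => r * f t) (r * a) (r * c) := by
  obtain ⟨b, hb⟩ := hf
  exact ⟨r * b, fun t => by simp only [hb]; ring⟩

theorem sum {ι : Type*} (s : Finset ι) {f : ι → ℝ → ℝ} {a c : ι → ℝ}
    (hf : ∀ i, IsQuadratic (f i) (a i) (c i)) :
    IsQuadratic (fun t => ∑ i ∈ s, f i t) (∑ i ∈ s, a i) (∑ i ∈ s, c i) := by
  choose b hb using hf
  refine ⟨∑ i ∈ s, b i, fun t => ?_⟩
  simp only [hb, Finset.sum_add_distrib, Finset.mul_sum]

theorem bilinear {p r : ℕ} (M : Matrix (Fin p) (Fin r) ℝ) (x x' : Fin p → ℝ) (y y' : Fin r → ℝ) :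
    IsQuadratic (fun t => (t • x + x') ⬝ᵥ M *ᵥ (t • y + y')) (x ⬝ᵥ M *ᵥ y) (x' ⬝ᵥ M *ᵥ y') := by
  refine ⟨x ⬝ᵥ M *ᵥ y' + x' ⬝ᵥ M *ᵥ y, fun t => ?_⟩
  simp only [mulVec_add, mulVec_smul, add_dotProduct, dotProduct_add, smul_dotProduct,
    dotProduct_smul, smul_eq_mul]
  ring

/-- The vanishing leading coefficient is written `0 ⬝ᵥ x` so that it matches the linear terms of the
homogeneous cost by unfolding. -/
theorem linear {p : ℕ} (q x x' : Fin p → ℝ) :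
    IsQuadratic (fun t => q ⬝ᵥ (t • x + x')) (0 ⬝ᵥ x) (q ⬝ᵥ x') := by
  refine ⟨q ⬝ᵥ x, fun t => ?_⟩
  simp only [dotProduct_add, dotProduct_smul, smul_eq_mul, zero_dotProduct]
  ring

end IsQuadratic

/-! ### Reduction to the homogeneous problem -/

section Homogeneous

variable {Ω : Type*} {n m : ℕ}

/-- The problem without inhomogeneous and linear terms. -/
def Data.homog (d : Data Ω n m) : Data Ω n m :=
  { d with b := 0, σ := 0, q := 0, qb := 0, ρ := 0, ρb := 0, g := 0, gb := 0 }

/-- The strategy without its inhomogeneous term. -/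
def Strategy.homog (s : Strategy n m) : Strategy n m := { s with v := 0 }

/-- The integrand of the cost functional at the sample point `ω`, as a function of the values of
the state, of the control and of their means. -/
def Data.pathCost (d : Data Ω n m) (l : ℕ) (ω : Ω) (x Ex : ℕ → Fin n → ℝ) (u Eu : ℕ → Fin m → ℝ) :
    ℝ :=
  x d.N ⬝ᵥ d.G *ᵥ x d.N + 2 * (d.g ω ⬝ᵥ x d.N)
    + Ex d.N ⬝ᵥ d.Gb *ᵥ Ex d.N + 2 * (d.gb ω ⬝ᵥ Ex d.N)
    + ∑ k ∈ Finset.Ico l d.N,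
        (x k ⬝ᵥ d.Q k *ᵥ x k + 2 * (u k ⬝ᵥ d.S k *ᵥ x k) + u k ⬝ᵥ d.R k *ᵥ u k
          + 2 * (d.q k ω ⬝ᵥ x k) + 2 * (d.ρ k ω ⬝ᵥ u k))
    + ∑ k ∈ Finset.Ico l d.N,
        (Ex k ⬝ᵥ d.Qb k *ᵥ Ex k + 2 * (Eu k ⬝ᵥ d.Sb k *ᵥ Ex k) + Eu k ⬝ᵥ d.Rb k *ᵥ Eu k
          + 2 * (d.qb k ω ⬝ᵥ Ex k) + 2 * (d.ρb k ω ⬝ᵥ Eu k))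

/-- Superposition of trajectories is available only on `{l, …, N}`, and nothing is known about
controls at other times. -/
theorem Data.pathCost_congr (d : Data Ω n m) (l : ℕ) (hl : l ≤ d.N) (ω : Ω)
    {x Ex x' Ex' : ℕ → Fin n → ℝ} {u Eu u' Eu' : ℕ → Fin m → ℝ}
    (hx : ∀ k, l ≤ k → k ≤ d.N → x k = x' k) (hEx : ∀ k, l ≤ k → k ≤ d.N → Ex k = Ex' k)
    (hu : ∀ k, l ≤ k → k < d.N → u k = u' k) (hEu : ∀ k, l ≤ k → k < d.N → Eu k = Eu' k) :
    d.pathCost l ω x Ex u Eu = d.pathCost l ω x' Ex' u' Eu' := by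
  unfold Data.pathCost
  rw [hx d.N hl le_rfl, hEx d.N hl le_rfl]
  congr 1
  · congr 1
    refine Finset.sum_congr rfl fun k hk => ?_
    obtain ⟨h₁, h₂⟩ := Finset.mem_Ico.1 hk
    rw [hx k h₁ h₂.le, hu k h₁ h₂]
  · refine Finset.sum_congr rfl fun k hk => ?_
    obtain ⟨h₁, h₂⟩ := Finset.mem_Ico.1 hk
    rw [hEx k h₁ h₂.le, hEu k h₁ h₂]

theorem Data.isQuadratic_pathCost (d : Data Ω n m) (l : ℕ) (ω : Ω)
    (x Ex x' Ex' : ℕ → Fin n → ℝ) (u Eu u' Eu' : ℕ → Fin m → ℝ) :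
    IsQuadratic (fun t => d.pathCost l ω (fun k => t • x k + x' k) (fun k => t • Ex k + Ex' k)
      (fun k => t • u k + u' k) (fun k => t • Eu k + Eu' k))
      (d.homog.pathCost l ω x Ex u Eu) (d.pathCost l ω x' Ex' u' Eu') := by
  open IsQuadratic in
  exact (((((bilinear _ _ _ _ _).add ((linear _ _ _).const_mul 2)).add
    (bilinear _ _ _ _ _)).add ((linear _ _ _).const_mul 2)).add
    (IsQuadratic.sum _ fun k => ((((bilinear _ _ _ _ _).add
      ((bilinear _ _ _ _ _).const_mul 2)).add (bilinear _ _ _ _ _)).add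
      ((linear _ _ _).const_mul 2)).add ((linear _ _ _).const_mul 2))).add
    (IsQuadratic.sum _ fun k => ((((bilinear _ _ _ _ _).add
      ((bilinear _ _ _ _ _).const_mul 2)).add (bilinear _ _ _ _ _)).add
      ((linear _ _ _).const_mul 2)).add ((linear _ _ _).const_mul 2))

variable {mΩ : MeasurableSpace Ω} {P : Measure Ω} {d : Data Ω n m}
  {l k : ℕ} {ξ : Ω → Fin n → ℝ} {u : ℕ → Ω → Fin m → ℝ}

theorem Data.cost_eq_integral_pathCost (d : Data Ω n m) (l : ℕ) (ξ : Ω → Fin n → ℝ)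
    (u : ℕ → Ω → Fin m → ℝ) :
    d.cost P l ξ u = ∫ ω, d.pathCost l ω (fun k => d.state P l ξ u k ω)
      (fun k => ∫ ω', d.state P l ξ u k ω' ∂P) (fun k => u k ω) (fun k => ∫ ω', u k ω' ∂P) ∂P :=
  rfl

theorem Data.SquareIntegrableWeights.homog : d.homog.SquareIntegrableWeights P := by
  constructor <;> intros <;> exact MemLp.zero

variable [IsProbabilityMeasure P]

theorem Data.integrable_pathCost (hd : d.SquareIntegrableWeights P) (hl : l ≤ d.N)
    {x : ℕ → Ω → Fin n → ℝ} (hx : ∀ k, l ≤ k → k ≤ d.N → MemLp (x k) 2 P)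
    (hu : ∀ k, l ≤ k → k < d.N → MemLp (u k) 2 P) (Ex : ℕ → Fin n → ℝ) (Eu : ℕ → Fin m → ℝ) :
    Integrable (fun ω => d.pathCost l ω (fun k => x k ω) Ex (fun k => u k ω) Eu) P := by
  refine ((((integrable_dotProduct_mulVec (hx _ hl le_rfl) (hx _ hl le_rfl) _).add
    ((integrable_dotProduct hd.g (hx _ hl le_rfl)).const_mul 2)).add (integrable_const _)).add
    ((integrable_dotProduct hd.gb (memLp_const _)).const_mul 2)).add
    (integrable_finsetSum _ fun k hk => ?_) |>.add (integrable_finsetSum _ fun k hk => ?_)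
  · obtain ⟨h₁, h₂⟩ := Finset.mem_Ico.1 hk
    have hxk := hx k h₁ h₂.le
    have huk := hu k h₁ h₂
    exact ((((integrable_dotProduct_mulVec hxk hxk _).add
      ((integrable_dotProduct_mulVec huk hxk _).const_mul 2)).add
      (integrable_dotProduct_mulVec huk huk _)).add
      ((integrable_dotProduct (hd.q k h₂) hxk).const_mul 2)).add
      ((integrable_dotProduct (hd.ρ k h₂) huk).const_mul 2)
  · obtain ⟨h₁, h₂⟩ := Finset.mem_Ico.1 hk
    exact ((integrable_const _).add
      ((integrable_dotProduct (hd.qb k h₂) (memLp_const _)).const_mul 2)).add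
      ((integrable_dotProduct (hd.ρb k h₂) (memLp_const _)).const_mul 2)

theorem integral_smul_add {t : ℝ} {x x' : Ω → Fin n → ℝ} (hx : MemLp x 2 P) (hx' : MemLp x' 2 P) :
    ∫ ω, (t • x ω + x' ω) ∂P = t • ∫ ω, x ω ∂P + ∫ ω, x' ω ∂P := by
  have i₁ : Integrable (fun ω => t • x ω) P := (hx.integrable one_le_two).smul t
  rw [integral_add i₁ (hx'.integrable one_le_two), integral_smul]

/-- The inhomogeneous terms enter once and are assigned to the primed pair, whose coefficient is
one; the pair scaled by `t` follows the homogeneous dynamics. -/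
theorem Data.step_smul_add (d : Data Ω n m) (k : ℕ) (t : ℝ) {x x' : Ω → Fin n → ℝ}
    {u u' : Ω → Fin m → ℝ} (hx : MemLp x 2 P) (hx' : MemLp x' 2 P) (hu : MemLp u 2 P)
    (hu' : MemLp u' 2 P) :
    d.step P k (fun ω => t • x ω + x' ω) (fun ω => t • u ω + u' ω)
      = fun ω => t • d.homog.step P k x u ω + d.step P k x' u' ω := by
  funext ω
  simp only [Data.step, integral_smul_add hx hx', integral_smul_add hu hu', mulVec_add,
    mulVec_smul, Data.homog, Pi.zero_apply]
  module

theorem Strategy.feedback_smul_add (s : Strategy n m) (k : ℕ) (t : ℝ) {x x' : Ω → Fin n → ℝ}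
    (hx : MemLp x 2 P) (hx' : MemLp x' 2 P) :
    s.feedback P k (fun ω => t • x ω + x' ω)
      = fun ω => t • s.homog.feedback P k x ω + s.feedback P k x' ω := by
  funext ω
  simp only [Strategy.feedback, integral_smul_add hx hx', mulVec_add, mulVec_smul,
    Strategy.homog, Pi.zero_apply]
  module

theorem Data.state_smul_add (d : Data Ω n m) (t : ℝ) {ξ' : Ω → Fin n → ℝ}
    {u' : ℕ → Ω → Fin m → ℝ}
    (hx : ∀ k, l ≤ k → k ≤ d.N → MemLp (d.homog.state P l ξ u k) 2 P)
    (hx' : ∀ k, l ≤ k → k ≤ d.N → MemLp (d.state P l ξ' u' k) 2 P)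
    (hu : ∀ k, l ≤ k → k < d.N → MemLp (u k) 2 P)
    (hu' : ∀ k, l ≤ k → k < d.N → MemLp (u' k) 2 P) (hlk : l ≤ k) (hk : k ≤ d.N) :
    d.state P l (fun ω => t • ξ ω + ξ' ω) (fun k ω => t • u k ω + u' k ω) k
      = fun ω => t • d.homog.state P l ξ u k ω + d.state P l ξ' u' k ω := by
  induction k, hlk using Nat.le_induction with
  | base => simp only [Data.state_of_le _ _ _ le_rfl]
  | succ k hlk ih =>
    have hk' := Nat.le_of_succ_le hk
    rw [Data.state_succ _ _ _ hlk, Data.state_succ _ _ _ hlk, Data.state_succ _ _ _ hlk, ih hk',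
      d.step_smul_add k t (hx k hlk hk') (hx' k hlk hk') (hu k hlk hk) (hu' k hlk hk)]

/-- The integrand is quadratic in `t` at each sample point, with homogeneous leading coefficient,
and this survives integration. -/
theorem Data.cost_smul_add (hd : d.SquareIntegrableWeights P) (hl : l ≤ d.N)
    {ξ' : Ω → Fin n → ℝ} {u' : ℕ → Ω → Fin m → ℝ}
    (hx : ∀ k, l ≤ k → k ≤ d.N → MemLp (d.homog.state P l ξ u k) 2 P)
    (hx' : ∀ k, l ≤ k → k ≤ d.N → MemLp (d.state P l ξ' u' k) 2 P)
    (hu : ∀ k, l ≤ k → k < d.N → MemLp (u k) 2 P)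
    (hu' : ∀ k, l ≤ k → k < d.N → MemLp (u' k) 2 P) :
    IsQuadratic (fun t => d.cost P l (fun ω => t • ξ ω + ξ' ω) fun k ω => t • u k ω + u' k ω)
      (d.homog.cost P l ξ u) (d.cost P l ξ' u') := by
  set X := d.homog.state P l ξ u with hX
  set X' := d.state P l ξ' u' with hX'
  set f : ℝ → Ω → ℝ := fun t ω => d.pathCost l ω (fun k => t • X k ω + X' k ω)
    (fun k => t • (∫ ω', X k ω' ∂P) + ∫ ω', X' k ω' ∂P) (fun k => t • u k ω + u' k ω)
    (fun k => t • (∫ ω', u k ω' ∂P) + ∫ ω', u' k ω' ∂P) with hf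
  have hcost : ∀ t, d.cost P l (fun ω => t • ξ ω + ξ' ω) (fun k ω => t • u k ω + u' k ω)
      = ∫ ω, f t ω ∂P := by
    intro t
    rw [d.cost_eq_integral_pathCost]
    refine integral_congr_ae (ae_of_all _ fun ω => d.pathCost_congr l hl ω ?_ ?_ ?_ ?_)
    · intro k h₁ h₂
      simp only [d.state_smul_add t hx hx' hu hu' h₁ h₂, hX, hX']
    · intro k h₁ h₂
      simp only [d.state_smul_add t hx hx' hu hu' h₁ h₂, hX, hX']
      exact integral_smul_add (hx k h₁ h₂) (hx' k h₁ h₂)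
    · exact fun k _ _ => rfl
    · exact fun k h₁ h₂ => integral_smul_add (hu k h₁ h₂) (hu' k h₁ h₂)
  have hq := fun ω => d.isQuadratic_pathCost l ω (fun k => X k ω) (fun k => ∫ ω', X k ω' ∂P)
    (fun k => X' k ω) (fun k => ∫ ω', X' k ω' ∂P) (fun k => u k ω) (fun k => ∫ ω', u k ω' ∂P)
    (fun k => u' k ω) (fun k => ∫ ω', u' k ω' ∂P)
  choose b hb using hq
  set a : Ω → ℝ := fun ω => d.homog.pathCost l ω (fun k => X k ω) (fun k => ∫ ω', X k ω' ∂P)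
    (fun k => u k ω) (fun k => ∫ ω', u k ω' ∂P) with ha
  set c : Ω → ℝ := fun ω => d.pathCost l ω (fun k => X' k ω) (fun k => ∫ ω', X' k ω' ∂P)
    (fun k => u' k ω) (fun k => ∫ ω', u' k ω' ∂P) with hc
  have hfe : ∀ t ω, f t ω = t ^ 2 * a ω + t * b ω + c ω := fun t ω => hb ω t
  have ia : Integrable a P := Data.integrable_pathCost (d := d.homog) .homog hl hx hu _ _
  have ic : Integrable c P := Data.integrable_pathCost hd hl hx' hu' _ _
  have i₁ : Integrable (f 1) P :=
    Data.integrable_pathCost (x := fun k ω => (1 : ℝ) • X k ω + X' k ω)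
      (u := fun k ω => (1 : ℝ) • u k ω + u' k ω) hd hl
      (fun k h₁ h₂ => ((hx k h₁ h₂).const_smul (1 : ℝ)).add (hx' k h₁ h₂))
      (fun k h₁ h₂ => ((hu k h₁ h₂).const_smul (1 : ℝ)).add (hu' k h₁ h₂)) _ _
  have ib : Integrable b P := by
    -- The middle coefficient comes from pointwise choice; evaluation at `t = 1` recovers its
    -- measurability and integrability.
    have e : b = f 1 - a - c := by
      funext ω
      simp only [Pi.sub_apply, hfe]
      ring
    rw [e]
    exact (i₁.sub ia).sub ic
  refine ⟨∫ ω, b ω ∂P, fun t => ?_⟩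
  have i₂ : Integrable (fun ω => t ^ 2 * a ω + t * b ω) P :=
    (ia.const_mul _).add (ib.const_mul _)
  simp only [hcost, hfe]
  rw [integral_add i₂ ic, integral_add (ia.const_mul _) (ib.const_mul _), integral_const_mul,
    integral_const_mul]
  rfl

/-- A feedback loop is affine in its initial state. The summand `0` is kept so that the expression
has the shape used in `cost_smul_add` with `ξ' = 0`. -/
theorem Data.closedLoopState_smul_add (h : d.IsMartingaleDifference P)
    (s : Strategy n m) (hξ : d.IsInitialState P l ξ) (t : ℝ) (hlk : l ≤ k) (hk : k ≤ d.N) :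
    d.closedLoopState P s l (fun ω => t • ξ ω + 0) k
      = fun ω => t • d.homog.closedLoopState P s.homog l ξ k ω
        + d.closedLoopState P s l (fun _ => 0) k ω := by
  have hξ' : d.homog.IsInitialState P l ξ := ⟨hξ.1, hξ.2, hξ.3⟩
  have h' : d.homog.IsMartingaleDifference P := ⟨h.1, h.2, h.3, h.4⟩
  have h0 := d.isInitialState_const (P := P) l 0
  have u₁ := hξ'.admissible_closedLoopControl h' s.homog
  have u₀ := h0.admissible_closedLoopControl h s
  induction k, hlk using Nat.le_induction with
  | base => simp only [← Data.state_closedLoopControl, Data.state_of_le _ _ _ le_rfl]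
  | succ k hlk ih =>
    have hk' := Nat.le_of_succ_le hk
    have x₁ := (hξ'.isL2_state_of_admissible h' u₁ hlk hk').2
    have x₀ := (h0.isL2_state_of_admissible h u₀ hlk hk').2
    rw [Data.state_closedLoopControl] at x₀ x₁
    rw [Data.closedLoopState, Data.closedLoopState, Data.closedLoopState, if_neg (not_lt.2 hlk),
      if_neg (not_lt.2 hlk), if_neg (not_lt.2 hlk), ih hk', s.feedback_smul_add k t x₁ x₀]
    exact d.step_smul_add k t x₁ x₀ (u₁ k hlk hk).2 (u₀ k hlk hk).2

/-- A closed-loop optimal strategy for the problem is closed-loop optimal for the homogeneous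
problem, after removal of its inhomogeneous term. -/
theorem Data.IsClosedLoopOptimal.homog (h : d.IsMartingaleDifference P)
    (hd : d.SquareIntegrableWeights P) (hl : l ≤ d.N) {s : Strategy n m}
    (hs : d.IsClosedLoopOptimal P l s) : d.homog.IsClosedLoopOptimal P l s.homog := by
  intro ξ hξ' u hu'
  have hξ : d.IsInitialState P l ξ := ⟨hξ'.1, hξ'.2, hξ'.3⟩
  have h' : d.homog.IsMartingaleDifference P := ⟨h.1, h.2, h.3, h.4⟩
  have h0 := d.isInitialState_const (P := P) l 0
  have uc := hξ'.admissible_closedLoopControl h' s.homog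
  have u₀ := h0.admissible_closedLoopControl h s
  have x₀ := fun k h₁ h₂ => (h0.isL2_state_of_admissible h u₀ (k := k) h₁ h₂).2
  obtain ⟨b, hb⟩ := Data.cost_smul_add hd hl
    (fun k h₁ h₂ => (hξ'.isL2_state_of_admissible h' uc (k := k) h₁ h₂).2) x₀
    (fun k h₁ h₂ => (uc k h₁ h₂).2) (fun k h₁ h₂ => (u₀ k h₁ h₂).2)
  obtain ⟨b', hb'⟩ := Data.cost_smul_add hd hl
    (fun k h₁ h₂ => (hξ'.isL2_state_of_admissible h' hu' (k := k) h₁ h₂).2) x₀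
    (fun k h₁ h₂ => (hu' k h₁ h₂).2) (fun k h₁ h₂ => (u₀ k h₁ h₂).2)
  -- For `t ≠ 0` the states `ξ` and `t • ξ` generate the same field, so the combined control is
  -- admissible for `t • ξ`. Both costs have the same constant term, the cost of the closed loop
  -- from zero, and it cancels.
  have key : ∀ t : ℝ, t ≠ 0 → t ^ 2 * d.homog.cost P l ξ (d.homog.closedLoopControl P s.homog l ξ)
      + t * b ≤ t ^ 2 * d.homog.cost P l ξ u + t * b' := by
    intro t ht
    have e : ∀ ω, ξ ω = t⁻¹ • (t • ξ ω + 0) := fun ω => by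
      rw [add_zero, smul_smul, inv_mul_cancel₀ ht, one_smul]
    have c₁ : MeasurableSpace.comap (fun ω => t • ξ ω + 0) inferInstance
        ≤ MeasurableSpace.comap ξ inferInstance := by
      simpa only [add_zero] using comap_smul_le t ξ
    have c₂ : MeasurableSpace.comap ξ inferInstance
        ≤ MeasurableSpace.comap (fun ω => t • ξ ω + 0) inferInstance := by
      conv_lhs => rw [show ξ = fun ω => t⁻¹ • (t • ξ ω + 0) from funext e]
      exact comap_smul_le t⁻¹ _
    have hi : d.IsInitialState P l fun ω => t • ξ ω + 0 :=
      hξ.of_comap_le le_rfl ((hξ.memLp.const_smul t).add (memLp_const 0)) c₁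
    have hadm : d.Admissible P l (fun ω => t • ξ ω + 0)
        fun k ω => t • u k ω + d.closedLoopControl P s l (fun _ => 0) k ω := by
      intro k h₁ h₂
      refine IsL2.add (F := d.infoField (fun ω => t • ξ ω + 0) l k) ⟨?_, ?_⟩ ?_
      · exact Measurable.const_smul ((hu' k h₁ h₂).1.mono (sup_le_sup_right c₂ _) le_rfl) t
      · exact (hu' k h₁ h₂).2.const_smul t
      · refine IsL2.mono (F := d.infoField (fun _ => 0) l k) (u₀ k h₁ h₂) (sup_le_sup_right ?_ _)
        rw [MeasurableSpace.comap_const]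
        exact bot_le
    have hle := hs _ hi _ hadm
    have ec : d.cost P l (fun ω => t • ξ ω + 0)
        (d.closedLoopControl P s l fun ω => t • ξ ω + 0) =
        d.cost P l (fun ω => t • ξ ω + 0) fun k ω =>
          t • d.homog.closedLoopControl P s.homog l ξ k ω
            + d.closedLoopControl P s l (fun _ => 0) k ω := by
      have hcl : ∀ k, l ≤ k → k ≤ d.N →
          d.closedLoopControl P s l (fun ω => t • ξ ω + 0) k = fun ω =>
          t • d.homog.closedLoopControl P s.homog l ξ k ω
            + d.closedLoopControl P s l (fun _ => 0) k ω := by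
        intro k h₁ h₂
        have x₁ := (hξ'.isL2_state_of_admissible h' uc h₁ h₂).2
        have x₂ := x₀ k h₁ h₂
        rw [Data.state_closedLoopControl] at x₁ x₂
        rw [Data.closedLoopControl, Data.closedLoopState_smul_add h s hξ t h₁ h₂,
          s.feedback_smul_add k t x₁ x₂]
        rfl
      have hst : ∀ k, l ≤ k → k ≤ d.N →
          d.state P l (fun ω => t • ξ ω + 0) (d.closedLoopControl P s l fun ω => t • ξ ω + 0) k
          = d.state P l (fun ω => t • ξ ω + 0) (fun k ω =>
          t • d.homog.closedLoopControl P s.homog l ξ k ω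
            + d.closedLoopControl P s l (fun _ => 0) k ω) k := by
        intro k h₁
        induction k, h₁ using Nat.le_induction with
        | base => intro _; rw [Data.state_of_le _ _ _ le_rfl, Data.state_of_le _ _ _ le_rfl]
        | succ k h₁ ih =>
          intro h₂
          rw [Data.state_succ _ _ _ h₁, Data.state_succ _ _ _ h₁, ih (Nat.le_of_succ_le h₂),
            hcl k h₁ (Nat.le_of_succ_le h₂)]
      rw [d.cost_eq_integral_pathCost, d.cost_eq_integral_pathCost]
      refine integral_congr_ae (ae_of_all _ fun ω => d.pathCost_congr l hl ω ?_ ?_ ?_ ?_)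
      · exact fun k h₁ h₂ => congrFun (hst k h₁ h₂) ω
      · exact fun k h₁ h₂ => by rw [hst k h₁ h₂]
      · exact fun k h₁ h₂ => congrFun (hcl k h₁ h₂.le) ω
      · exact fun k h₁ h₂ => by rw [hcl k h₁ h₂.le]
    rw [ec] at hle
    have e₁ := hb t
    have e₂ := hb' t
    simp only at e₁ e₂
    rw [e₁, e₂] at hle
    linarith
  -- Adding the inequalities for `t = 1` and `t = -1` eliminates the unknown linear coefficients.
  have k₁ := key 1 one_ne_zero
  have k₂ := key (-1) (neg_ne_zero.2 one_ne_zero)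
  linarith

end Homogeneous

/-! ### One step of the homogeneous problem: fluctuation and mean -/

section OneStep

variable {Ω : Type*} {n m : ℕ} {F : MeasurableSpace Ω} {mΩ : MeasurableSpace Ω} {P : Measure Ω}
  {d : Data Ω n m} {l k : ℕ} {ξ : Ω → Fin n → ℝ} {u : ℕ → Ω → Fin m → ℝ}

/-- All inhomogeneous and linear terms vanish. -/
structure Data.IsHomogeneous (d : Data Ω n m) : Prop where
  b : d.b = 0
  σ : d.σ = 0
  q : d.q = 0
  qb : d.qb = 0
  ρ : d.ρ = 0
  ρb : d.ρb = 0
  g : d.g = 0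
  gb : d.gb = 0

theorem Data.isHomogeneous_homog (d : Data Ω n m) : d.homog.IsHomogeneous :=
  ⟨rfl, rfl, rfl, rfl, rfl, rfl, rfl, rfl⟩

/-- The one-step cost of fluctuations around the mean, with terminal weight `M`. -/
def Data.fluctuationForm (d : Data Ω n m) (M : Matrix (Fin n) (Fin n) ℝ) (k : ℕ) :
    (Fin n → ℝ) → (Fin m → ℝ) → ℝ :=
  stageForm (d.A k) (d.B k) (d.C k) (d.D k) M M (d.Q k) (d.S k) (d.R k)

/-- The one-step cost of the mean, with terminal weights `M` and `Mb`. -/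
def Data.meanForm (d : Data Ω n m) (M Mb : Matrix (Fin n) (Fin n) ℝ) (k : ℕ) :
    (Fin n → ℝ) → (Fin m → ℝ) → ℝ :=
  stageForm (d.A k + d.Ab k) (d.B k + d.Bb k) (d.C k + d.Cb k) (d.D k + d.Db k) Mb M
    (d.Q k + d.Qb k) (d.S k + d.Sb k) (d.R k + d.Rb k)

/-- The value functional: `M` weighs the fluctuation of `x`, `Mb` its mean. -/
noncomputable def value (P : Measure Ω) (M Mb : Matrix (Fin n) (Fin n) ℝ) (x : Ω → Fin n → ℝ) :
    ℝ :=
  ∫ ω, (x ω - ∫ ω', x ω' ∂P) ⬝ᵥ M *ᵥ (x ω - ∫ ω', x ω' ∂P) ∂P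
    + (∫ ω, x ω ∂P) ⬝ᵥ Mb *ᵥ ∫ ω, x ω ∂P

/-- The quadratic cost incurred at time `k`. -/
noncomputable def Data.stageCost (d : Data Ω n m) (P : Measure Ω) (k : ℕ) (x : Ω → Fin n → ℝ)
    (u : Ω → Fin m → ℝ) : ℝ :=
  ∫ ω, (x ω ⬝ᵥ d.Q k *ᵥ x ω + 2 * (u ω ⬝ᵥ d.S k *ᵥ x ω) + u ω ⬝ᵥ d.R k *ᵥ u ω) ∂P
    + ((∫ ω, x ω ∂P) ⬝ᵥ d.Qb k *ᵥ (∫ ω, x ω ∂P) + 2 * ((∫ ω, u ω ∂P) ⬝ᵥ d.Sb k *ᵥ ∫ ω, x ω ∂P)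
      + (∫ ω, u ω ∂P) ⬝ᵥ d.Rb k *ᵥ ∫ ω, u ω ∂P)

/-- The cost of one step from `x` under the control `u`, with terminal weights `M` and `Mb`. -/
noncomputable def Data.oneStepCost (d : Data Ω n m) (P : Measure Ω)
    (M Mb : Matrix (Fin n) (Fin n) ℝ) (k : ℕ) (x : Ω → Fin n → ℝ) (u : Ω → Fin m → ℝ) : ℝ :=
  ∫ ω, d.fluctuationForm M k (x ω - ∫ ω', x ω' ∂P) (u ω - ∫ ω', u ω' ∂P) ∂P
    + d.meanForm M Mb k (∫ ω, x ω ∂P) (∫ ω, u ω ∂P)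

theorem integral_quadratic {x : Ω → Fin n → ℝ} {u : Ω → Fin m → ℝ} (hx : MemLp x 2 P)
    (hu : MemLp u 2 P) (Q : Matrix (Fin n) (Fin n) ℝ) (S : Matrix (Fin m) (Fin n) ℝ)
    (R : Matrix (Fin m) (Fin m) ℝ) :
    ∫ ω, (x ω ⬝ᵥ Q *ᵥ x ω + 2 * (u ω ⬝ᵥ S *ᵥ x ω) + u ω ⬝ᵥ R *ᵥ u ω) ∂P =
      ∫ ω, x ω ⬝ᵥ Q *ᵥ x ω ∂P + 2 * ∫ ω, u ω ⬝ᵥ S *ᵥ x ω ∂P + ∫ ω, u ω ⬝ᵥ R *ᵥ u ω ∂P := by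
  have i₁ := integrable_dotProduct_mulVec hx hx Q
  have i₂ := (integrable_dotProduct_mulVec hu hx S).const_mul 2
  have i₃ := integrable_dotProduct_mulVec hu hu R
  have i₄ : Integrable (fun ω => x ω ⬝ᵥ Q *ᵥ x ω + 2 * (u ω ⬝ᵥ S *ᵥ x ω)) P := i₁.add i₂
  rw [integral_add i₄ i₃, integral_add i₁ i₂, integral_const_mul]

theorem integral_stageForm {x : Ω → Fin n → ℝ} {u : Ω → Fin m → ℝ} (hx : MemLp x 2 P)
    (hu : MemLp u 2 P) (A C P₁ P₂ Q : Matrix (Fin n) (Fin n) ℝ) (B D : Matrix (Fin n) (Fin m) ℝ)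
    (S : Matrix (Fin m) (Fin n) ℝ) (R : Matrix (Fin m) (Fin m) ℝ) :
    ∫ ω, stageForm A B C D P₁ P₂ Q S R (x ω) (u ω) ∂P =
      ∫ ω, (A *ᵥ x ω + B *ᵥ u ω) ⬝ᵥ P₁ *ᵥ (A *ᵥ x ω + B *ᵥ u ω) ∂P
        + ∫ ω, (C *ᵥ x ω + D *ᵥ u ω) ⬝ᵥ P₂ *ᵥ (C *ᵥ x ω + D *ᵥ u ω) ∂P
        + ∫ ω, x ω ⬝ᵥ Q *ᵥ x ω ∂P + 2 * ∫ ω, u ω ⬝ᵥ S *ᵥ x ω ∂P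
        + ∫ ω, u ω ⬝ᵥ R *ᵥ u ω ∂P := by
  have ha : MemLp (fun ω => A *ᵥ x ω + B *ᵥ u ω) 2 P := (memLp_mulVec hx A).add (memLp_mulVec hu B)
  have hc : MemLp (fun ω => C *ᵥ x ω + D *ᵥ u ω) 2 P := (memLp_mulVec hx C).add (memLp_mulVec hu D)
  have i₁ := integrable_dotProduct_mulVec ha ha P₁
  have i₂ := integrable_dotProduct_mulVec hc hc P₂
  have i₃ := integrable_dotProduct_mulVec hx hx Q
  have i₄ := (integrable_dotProduct_mulVec hu hx S).const_mul 2
  have i₅ := integrable_dotProduct_mulVec hu hu R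
  have i₁₂ := i₁.fun_add i₂
  have i₁₃ := i₁₂.fun_add i₃
  have i₁₄ := i₁₃.fun_add i₄
  simp only [stageForm]
  rw [integral_add i₁₄ i₅, integral_add i₁₃ i₄, integral_add i₁₂ i₃, integral_add i₁ i₂,
    integral_const_mul]

variable [IsProbabilityMeasure P]

theorem integral_affine {n' : ℕ} {x : Ω → Fin n → ℝ} {u : Ω → Fin m → ℝ} (hx : Integrable x P)
    (hu : Integrable u P) (A : Matrix (Fin n') (Fin n) ℝ) (B : Matrix (Fin n') (Fin m) ℝ)
    (a b : Fin n' → ℝ) :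
    ∫ ω, (A *ᵥ x ω + a + B *ᵥ u ω + b) ∂P
      = A *ᵥ ∫ ω, x ω ∂P + a + B *ᵥ ∫ ω, u ω ∂P + b := by
  have i₁ : Integrable (fun ω => A *ᵥ x ω) P :=
    (LinearMap.toContinuousLinearMap A.mulVecLin).integrable_comp hx
  have i₂ : Integrable (fun ω => B *ᵥ u ω) P :=
    (LinearMap.toContinuousLinearMap B.mulVecLin).integrable_comp hu
  have i₃ : Integrable (fun ω => A *ᵥ x ω + a) P := i₁.add (integrable_const a)
  have i₄ : Integrable (fun ω => A *ᵥ x ω + a + B *ᵥ u ω) P := i₃.add i₂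
  rw [integral_add i₄ (integrable_const b), integral_add i₃ i₂,
    integral_add i₁ (integrable_const a), integral_mulVec hx, integral_mulVec hu]
  simp only [integral_const, probReal_univ, one_smul]

/-- One step of the system: the stage cost plus the expected value of the successor. -/
theorem Data.value_step_add_stageCost (hd : d.IsHomogeneous) {x : Ω → Fin n → ℝ}
    {u : Ω → Fin m → ℝ} (hw : IsUnitNoise P F (d.w k)) (hx : IsL2 P F x) (hu : IsL2 P F u)
    (M Mb : Matrix (Fin n) (Fin n) ℝ) :
    value P M Mb (d.step P k x u) + d.stageCost P k x u = d.oneStepCost P M Mb k x u := by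
  set xb := ∫ ω, x ω ∂P with hxb
  set ub := ∫ ω, u ω ∂P with hub
  set a : Ω → Fin n → ℝ := fun ω => d.A k *ᵥ x ω + d.Ab k *ᵥ xb + d.B k *ᵥ u ω + d.Bb k *ᵥ ub
    with ha
  set c : Ω → Fin n → ℝ := fun ω => d.C k *ᵥ x ω + d.Cb k *ᵥ xb + d.D k *ᵥ u ω + d.Db k *ᵥ ub
    with hc
  have hstep : d.step P k x u = fun ω => a ω + d.w k ω • c ω := by
    funext ω
    simp only [Data.step, hd.b, hd.σ, Pi.zero_apply, add_zero, ha, hc, hxb, hub]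
  have la : IsL2 P F a :=
    (((hx.mulVec _).add (isL2_const F _)).add (hu.mulVec _)).add (isL2_const F _)
  have lc : IsL2 P F c :=
    (((hx.mulVec _).add (isL2_const F _)).add (hu.mulVec _)).add (isL2_const F _)
  have Ea : ∫ ω, a ω ∂P = (d.A k + d.Ab k) *ᵥ xb + (d.B k + d.Bb k) *ᵥ ub := by
    rw [ha, integral_affine hx.integrable hu.integrable, add_mulVec, add_mulVec]
    abel
  have Ec : ∫ ω, c ω ∂P = (d.C k + d.Cb k) *ᵥ xb + (d.D k + d.Db k) *ᵥ ub := by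
    rw [hc, integral_affine hx.integrable hu.integrable, add_mulVec, add_mulVec]
    abel
  have hwc := IsL2.smul_noise hw lc
  have Ey : ∫ ω, (a ω + d.w k ω • c ω) ∂P = ∫ ω, a ω ∂P := by
    rw [integral_add la.integrable (hwc.integrable one_le_two), lc.integral_smul_noise hw, add_zero]
  -- The successor has the mean of `a`, so the mean of the diffusion `c` contributes only to the
  -- fluctuation of the successor. This is why `meanForm` weighs the drift with `Mb` and the
  -- diffusion with `M`.
  have v₁ := integral_dotProduct_mulVec (la.2.add hwc) (la.2.add hwc) M
  simp only [Pi.add_apply, integral_drift_add_noise hw la lc M, Ey] at v₁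
  have v₂ := integral_dotProduct_mulVec la.2 la.2 M
  have v₃ := integral_dotProduct_mulVec lc.2 lc.2 M
  have da : ∀ ω, a ω - ∫ ω', a ω' ∂P = d.A k *ᵥ (x ω - xb) + d.B k *ᵥ (u ω - ub) := by
    intro ω
    rw [Ea]
    simp only [ha, add_mulVec, mulVec_sub]
    abel
  have dc : ∀ ω, c ω - ∫ ω', c ω' ∂P = d.C k *ᵥ (x ω - xb) + d.D k *ᵥ (u ω - ub) := by
    intro ω
    rw [Ec]
    simp only [hc, add_mulVec, mulVec_sub]
    abel
  simp only [da] at v₂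
  simp only [dc] at v₃
  have sQ := integral_dotProduct_mulVec hx.2 hx.2 (d.Q k)
  have sS := integral_dotProduct_mulVec hu.2 hx.2 (d.S k)
  have sR := integral_dotProduct_mulVec hu.2 hu.2 (d.R k)
  rw [← hxb] at sQ sS
  rw [← hub] at sS sR
  have hform := integral_stageForm (P := P) (hx.2.sub (memLp_const xb)) (hu.2.sub (memLp_const ub))
    (d.A k) (d.C k) M M (d.Q k) (d.B k) (d.D k) (d.S k) (d.R k)
  simp only [Pi.sub_apply] at hform
  rw [hstep, value, Data.stageCost, Data.oneStepCost, Data.fluctuationForm, Data.meanForm,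
    integral_quadratic hx.2 hu.2, ← hxb, ← hub, hform, Ey]
  simp only [stageForm, ← Ea, ← Ec, add_mulVec (d.Q k), add_mulVec (d.S k), add_mulVec (d.R k),
    dotProduct_add]
  linarith

/-- The cost of the homogeneous problem is a sum of stage costs and a terminal value. -/
theorem Data.IsHomogeneous.cost_eq (hd : d.IsHomogeneous) (hl : l ≤ d.N)
    (hx : ∀ k, l ≤ k → k ≤ d.N → MemLp (d.state P l ξ u k) 2 P)
    (hu : ∀ k, l ≤ k → k < d.N → MemLp (u k) 2 P) :
    d.cost P l ξ u = value P d.G (d.G + d.Gb) (d.state P l ξ u d.N)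
      + ∑ k ∈ Finset.Ico l d.N, d.stageCost P k (d.state P l ξ u k) (u k) := by
  set X := d.state P l ξ u with hX
  have iG := integrable_dotProduct_mulVec (hx _ hl le_rfl) (hx _ hl le_rfl) d.G
  have iS : ∀ k ∈ Finset.Ico l d.N, Integrable (fun ω => X k ω ⬝ᵥ d.Q k *ᵥ X k ω
      + 2 * (u k ω ⬝ᵥ d.S k *ᵥ X k ω) + u k ω ⬝ᵥ d.R k *ᵥ u k ω) P := by
    intro k hk
    obtain ⟨h₁, h₂⟩ := Finset.mem_Ico.1 hk
    have hxk := hx k h₁ h₂.le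
    have huk := hu k h₁ h₂
    exact ((integrable_dotProduct_mulVec hxk hxk _).add
      ((integrable_dotProduct_mulVec huk hxk _).const_mul 2)).add
      (integrable_dotProduct_mulVec huk huk _)
  have iS' := integrable_finsetSum _ iS
  simp only [Data.cost, ← hX, hd.q, hd.qb, hd.ρ, hd.ρb, hd.g, hd.gb, Pi.zero_apply,
    zero_dotProduct, mul_zero, add_zero]
  have i₁ := iG.add (integrable_const ((∫ ω, X d.N ω ∂P) ⬝ᵥ d.Gb *ᵥ ∫ ω, X d.N ω ∂P))
  have i₂ := i₁.add iS'
  simp only [Pi.add_def] at i₁ i₂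
  rw [integral_add i₂ (integrable_const _), integral_add i₁ iS',
    integral_add iG (integrable_const _), integral_finsetSum _ iS,
    integral_dotProduct_mulVec (hx _ hl le_rfl) (hx _ hl le_rfl) d.G]
  simp only [integral_const, probReal_univ, one_smul, value, Data.stageCost,
    Finset.sum_add_distrib, add_mulVec, dotProduct_add]
  ring

end OneStep

section Verification

variable {Ω : Type*} {n m : ℕ} {d : Data Ω n m} {l k : ℕ}
  {M Mb : ℕ → Matrix (Fin n) (Fin n) ℝ}

/-! ### Regularity at one time -/

/-- The regularity conditions on a solution of the Riccati equations at time `k`. -/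
structure Data.IsRegularAt (d : Data Ω n m) (M Mb : ℕ → Matrix (Fin n) (Fin n) ℝ) (k : ℕ) :
    Prop where
  ups_nonneg : (d.Ups M k).PosSemidef
  upsBar_nonneg : (d.UpsBar M Mb k).PosSemidef
  range_le : LinearMap.range (d.H M k).mulVecLin ≤ LinearMap.range (d.Ups M k).mulVecLin
  range_bar_le :
    LinearMap.range (d.HBar M Mb k).mulVecLin ≤ LinearMap.range (d.UpsBar M Mb k).mulVecLin

theorem transpose_conj_of_transpose_eq {p r : ℕ} {M : Matrix (Fin p) (Fin p) ℝ} (hM : Mᵀ = M)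
    (A : Matrix (Fin p) (Fin r) ℝ) : (Aᵀ * M * A)ᵀ = Aᵀ * M * A := by
  rw [transpose_mul, transpose_mul, transpose_transpose, hM, Matrix.mul_assoc]

theorem Data.transpose_Ups (hs : d.SymmetricWeights) (hk : k < d.N)
    (hM : (M (k + 1))ᵀ = M (k + 1)) : (d.Ups M k)ᵀ = d.Ups M k := by
  simp only [Data.Ups, transpose_add, transpose_conj_of_transpose_eq hM, hs.R k hk]

theorem Data.transpose_UpsBar (hs : d.SymmetricWeights) (hk : k < d.N)
    (hM : (M (k + 1))ᵀ = M (k + 1)) (hMb : (Mb (k + 1))ᵀ = Mb (k + 1)) :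
    (d.UpsBar M Mb k)ᵀ = d.UpsBar M Mb k := by
  rw [Data.UpsBar, transpose_add, transpose_add, transpose_conj_of_transpose_eq hM,
    transpose_conj_of_transpose_eq hMb, transpose_add (d.R k), hs.R k hk, hs.Rb k hk]

theorem transpose_pinv_of_transpose_eq {p : ℕ} {U : Matrix (Fin p) (Fin p) ℝ} (hU : Uᵀ = U) :
    (pinv U)ᵀ = pinv U := by
  rw [transpose_pinv, hU]

theorem Data.IsGRESolution.transpose_eq (h : d.IsGRESolution M Mb) (hs : d.SymmetricWeights)
    (hk : k ≤ d.N) : (M k)ᵀ = M k ∧ (Mb k)ᵀ = Mb k := by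
  induction hk using Nat.decreasingInduction with
  | self => rw [h.P_final, h.Pi_final, transpose_add, hs.G, hs.Gb]; exact ⟨rfl, rfl⟩
  | of_succ k hk ih =>
    constructor
    · rw [h.P_step k hk, transpose_sub, transpose_add, transpose_add, hs.Q k hk,
        transpose_conj_of_transpose_eq ih.1, transpose_conj_of_transpose_eq ih.1,
        transpose_conj_of_transpose_eq
          (transpose_pinv_of_transpose_eq (Data.transpose_Ups hs hk ih.1))]
    · rw [h.Pi_step k hk, transpose_sub, transpose_add, transpose_add, transpose_add (d.Q k),
        hs.Q k hk, hs.Qb k hk,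
        transpose_conj_of_transpose_eq ih.1, transpose_conj_of_transpose_eq ih.2,
        transpose_conj_of_transpose_eq
          (transpose_pinv_of_transpose_eq (Data.transpose_UpsBar hs hk ih.1 ih.2))]

theorem Data.fluctuationForm_eq (hM : (M (k + 1))ᵀ = M (k + 1)) (x : Fin n → ℝ)
    (u : Fin m → ℝ) :
    d.fluctuationForm (M (k + 1)) k x u =
      x ⬝ᵥ (d.Q k + (d.A k)ᵀ * M (k + 1) * d.A k + (d.C k)ᵀ * M (k + 1) * d.C k) *ᵥ x
        + 2 * (u ⬝ᵥ d.H M k *ᵥ x) + u ⬝ᵥ d.Ups M k *ᵥ u :=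
  stageForm_eq _ _ _ _ _ _ _ hM hM x u

theorem Data.meanForm_eq (hM : (M (k + 1))ᵀ = M (k + 1)) (hMb : (Mb (k + 1))ᵀ = Mb (k + 1))
    (x : Fin n → ℝ) (u : Fin m → ℝ) :
    d.meanForm (M (k + 1)) (Mb (k + 1)) k x u =
      x ⬝ᵥ (d.Q k + d.Qb k + (d.A k + d.Ab k)ᵀ * Mb (k + 1) * (d.A k + d.Ab k)
        + (d.C k + d.Cb k)ᵀ * M (k + 1) * (d.C k + d.Cb k)) *ᵥ x
        + 2 * (u ⬝ᵥ d.HBar M Mb k *ᵥ x) + u ⬝ᵥ d.UpsBar M Mb k *ᵥ u := by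
  rw [Data.meanForm, stageForm_eq _ _ _ _ _ _ _ hMb hM, ← add_assoc _ (d.S k) (d.Sb k)]
  rfl

/-! ### Verification -/

variable {mΩ : MeasurableSpace Ω} {P : Measure Ω} {ξ : Ω → Fin n → ℝ} {u : ℕ → Ω → Fin m → ℝ}

/-- The suboptimality of the control `u` at time `k` in state `x`. -/
noncomputable def Data.gap (d : Data Ω n m) (P : Measure Ω)
    (M Mb : ℕ → Matrix (Fin n) (Fin n) ℝ) (k : ℕ) (x : Ω → Fin n → ℝ) (u : Ω → Fin m → ℝ) : ℝ :=
  let K := pinv (d.Ups M k) * d.H M k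
  let Kb := pinv (d.UpsBar M Mb k) * d.HBar M Mb k
  let xb := ∫ ω, x ω ∂P
  let ub := ∫ ω, u ω ∂P
  ∫ ω, (u ω - ub + K *ᵥ (x ω - xb)) ⬝ᵥ d.Ups M k *ᵥ (u ω - ub + K *ᵥ (x ω - xb)) ∂P
    + (ub + Kb *ᵥ xb) ⬝ᵥ d.UpsBar M Mb k *ᵥ (ub + Kb *ᵥ xb)

theorem Data.IsRegularAt.gap_nonneg (h : d.IsRegularAt M Mb k) (x : Ω → Fin n → ℝ)
    (u : Ω → Fin m → ℝ) : 0 ≤ d.gap P M Mb k x u := by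
  have h₁ := fun z => h.ups_nonneg.dotProduct_mulVec_nonneg z
  have h₂ := fun z => h.upsBar_nonneg.dotProduct_mulVec_nonneg z
  simp only [star_trivial] at h₁ h₂
  exact add_nonneg (integral_nonneg fun ω => h₁ _) (h₂ _)

/-- The strategy that closes the loop with the Riccati gains. -/
noncomputable def Data.gainStrategy (d : Data Ω n m) (M Mb : ℕ → Matrix (Fin n) (Fin n) ℝ) :
    Strategy n m where
  Θ k := -(pinv (d.Ups M k) * d.H M k)
  Θb k := pinv (d.Ups M k) * d.H M k - pinv (d.UpsBar M Mb k) * d.HBar M Mb k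
  v _ := 0

variable [IsProbabilityMeasure P]

theorem integral_feedback (s : Strategy n m) (k : ℕ) {x : Ω → Fin n → ℝ} (hx : Integrable x P) :
    ∫ ω, s.feedback P k x ω ∂P = (s.Θ k + s.Θb k) *ᵥ ∫ ω, x ω ∂P + s.v k := by
  have i₁ : Integrable (fun ω => s.Θ k *ᵥ x ω) P :=
    (LinearMap.toContinuousLinearMap (s.Θ k).mulVecLin).integrable_comp hx
  have i₂ := i₁.fun_add (integrable_const (s.Θb k *ᵥ ∫ ω', x ω' ∂P))
  simp only [Strategy.feedback]
  rw [integral_add i₂ (integrable_const _), integral_add i₁ (integrable_const _),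
    integral_mulVec hx, add_mulVec]
  simp only [integral_const, probReal_univ, one_smul]

/-- The fluctuation is fed back with `-K` and the mean with `-K + (K - Kb) = -Kb`, so both completed
squares vanish. -/
theorem Data.gap_gainStrategy {x : Ω → Fin n → ℝ} (hx : Integrable x P) :
    d.gap P M Mb k x ((d.gainStrategy M Mb).feedback P k x) = 0 := by
  have hb : ∫ ω, (d.gainStrategy M Mb).feedback P k x ω ∂P
      = -((pinv (d.UpsBar M Mb k) * d.HBar M Mb k) *ᵥ ∫ ω, x ω ∂P) := by
    rw [integral_feedback _ k hx]
    simp only [Data.gainStrategy, add_zero, ← neg_mulVec]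
    congr 1
    abel
  have hf : ∀ ω, (d.gainStrategy M Mb).feedback P k x ω
      - -((pinv (d.UpsBar M Mb k) * d.HBar M Mb k) *ᵥ ∫ ω, x ω ∂P)
      + (pinv (d.Ups M k) * d.H M k) *ᵥ (x ω - ∫ ω', x ω' ∂P) = 0 := by
    intro ω
    simp only [Strategy.feedback, Data.gainStrategy, neg_mulVec, sub_mulVec, mulVec_sub]
    abel
  simp only [Data.gap, hb, hf, neg_add_cancel, zero_dotProduct, integral_zero, add_zero]

/-- The square is completed separately in the fluctuation and in the mean. The range conditions make
this exact, and the Riccati equations identify what remains as the value at time `k`. -/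
theorem Data.IsRegularAt.oneStepCost_eq (h : d.IsRegularAt M Mb k) (hG : d.IsGRESolution M Mb)
    (hs : d.SymmetricWeights) (hk : k < d.N) {x : Ω → Fin n → ℝ} {u : Ω → Fin m → ℝ}
    (hx : MemLp x 2 P) (hu : MemLp u 2 P) :
    d.oneStepCost P (M (k + 1)) (Mb (k + 1)) k x u
      = value P (M k) (Mb k) x + d.gap P M Mb k x u := by
  obtain ⟨hM, hMb⟩ := hG.transpose_eq hs (Nat.succ_le_of_lt hk)
  have hx' : MemLp (fun ω => x ω - ∫ ω', x ω' ∂P) 2 P := hx.sub (memLp_const _)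
  have hu' : MemLp (fun ω => u ω - ∫ ω', u ω' ∂P + (pinv (d.Ups M k) * d.H M k) *ᵥ
      (x ω - ∫ ω', x ω' ∂P)) 2 P := (hu.sub (memLp_const _)).add (memLp_mulVec hx' _)
  have hU := Data.transpose_Ups hs hk hM
  have hUb := Data.transpose_UpsBar hs hk hM hMb
  simp only [Data.oneStepCost, Data.fluctuationForm_eq hM, Data.meanForm_eq hM hMb,
    complete_square _ _ hU h.range_le, complete_square _ _ hUb h.range_bar_le, ← hG.P_step k hk,
    ← hG.Pi_step k hk]
  rw [integral_add (integrable_dotProduct_mulVec hx' hx' _)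
    (integrable_dotProduct_mulVec hu' hu' _), value, Data.gap]
  ring

/-- The cost-to-go from time `j` equals the value of the state plus the later gaps. -/
theorem Data.value_add_sum_gap (h : d.IsMartingaleDifference P) (hd : d.IsHomogeneous)
    (hs : d.SymmetricWeights) (hG : d.IsGRESolution M Mb) (hξ : d.IsInitialState P l ξ)
    (hu : d.Admissible P l ξ u) {j : ℕ} (hj : j ≤ d.N) (hlj : l ≤ j)
    (hreg : ∀ k, j ≤ k → k < d.N → d.IsRegularAt M Mb k) :
    value P d.G (d.G + d.Gb) (d.state P l ξ u d.N)
        + ∑ k ∈ Finset.Ico j d.N, d.stageCost P k (d.state P l ξ u k) (u k)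
      = value P (M j) (Mb j) (d.state P l ξ u j)
        + ∑ k ∈ Finset.Ico j d.N, d.gap P M Mb k (d.state P l ξ u k) (u k) := by
  induction hj using Nat.decreasingInduction with
  | self => rw [hG.P_final, hG.Pi_final]; simp
  | of_succ j hj ih =>
    have e := ih (hlj.trans j.le_succ) fun k h₁ h₂ => hreg k (j.le_succ.trans h₁) h₂
    have hx := hξ.isL2_state_of_admissible h hu hlj hj.le
    have o := (hreg j le_rfl hj).oneStepCost_eq hG hs hj hx.2 (hu j hlj hj).2
    rw [← Data.value_step_add_stageCost hd (hξ.isUnitNoise h hlj hj) hx (hu j hlj hj),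
      ← d.state_succ ξ u hlj] at o
    rw [Finset.sum_eq_sum_Ico_succ_bot hj, Finset.sum_eq_sum_Ico_succ_bot hj]
    linarith

/-- If the Riccati solution is regular after time `l`, then a closed-loop optimal strategy
minimises the one-step cost at time `l`. -/
theorem Data.IsClosedLoopOptimal.oneStepCost_le (h : d.IsMartingaleDifference P)
    (hd : d.IsHomogeneous) (hs : d.SymmetricWeights) (hG : d.IsGRESolution M Mb) (hl : l < d.N)
    (hreg : ∀ k, l < k → k < d.N → d.IsRegularAt M Mb k) {s : Strategy n m}
    (hopt : d.IsClosedLoopOptimal P l s) (hξ : d.IsInitialState P l ξ) (s' : Strategy n m) :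
    d.oneStepCost P (M (l + 1)) (Mb (l + 1)) l ξ (s.feedback P l ξ)
      ≤ d.oneStepCost P (M (l + 1)) (Mb (l + 1)) l ξ (s'.feedback P l ξ) := by
  have key : ∀ s : Strategy n m, d.cost P l ξ (d.closedLoopControl P s l ξ)
      = d.oneStepCost P (M (l + 1)) (Mb (l + 1)) l ξ (s.feedback P l ξ)
        + ∑ k ∈ Finset.Ico (l + 1) d.N,
          d.gap P M Mb k (d.closedLoopState P s l ξ k) (d.closedLoopControl P s l ξ k) := by
    intro s
    have hu := hξ.admissible_closedLoopControl h s
    have hx := fun k h₁ h₂ => hξ.isL2_state_of_admissible h hu (k := k) h₁ h₂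
    have e := Data.value_add_sum_gap h hd hs hG hξ hu (Nat.succ_le_of_lt hl) l.le_succ
      fun k h₁ h₂ => hreg k h₁ h₂
    have o := Data.value_step_add_stageCost hd (hξ.isUnitNoise h le_rfl hl) (hx l le_rfl hl.le)
      (hu l le_rfl hl) (M (l + 1)) (Mb (l + 1))
    have c₀ : d.closedLoopControl P s l ξ l = s.feedback P l ξ := by
      rw [Data.closedLoopControl, ← d.state_closedLoopControl, d.state_of_le _ _ le_rfl]
    rw [← d.state_succ _ _ le_rfl] at o
    rw [hd.cost_eq hl.le (fun k h₁ h₂ => (hx k h₁ h₂).2) (fun k h₁ h₂ => (hu k h₁ h₂).2),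
      Finset.sum_eq_sum_Ico_succ_bot hl, ← c₀]
    simp only [← d.state_closedLoopControl]
    rw [d.state_of_le _ _ le_rfl] at o ⊢
    linarith
  -- The competitor follows `s'` at time `l` and the Riccati gains afterwards. Its later gaps are
  -- zero while those of `s` are nonnegative, so only the one-step costs remain to be compared.
  obtain ⟨r, r₀, r₁⟩ : ∃ r : Strategy n m, r.feedback P l ξ = s'.feedback P l ξ ∧
      ∀ k x, l < k → r.feedback P k x = (d.gainStrategy M Mb).feedback P k x := by
    refine ⟨⟨Function.update (d.gainStrategy M Mb).Θ l (s'.Θ l),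
      Function.update (d.gainStrategy M Mb).Θb l (s'.Θb l),
      Function.update (d.gainStrategy M Mb).v l (s'.v l)⟩, ?_, fun k x hk => ?_⟩
    · funext ω
      simp only [Strategy.feedback, Function.update_self]
    · funext ω
      simp only [Strategy.feedback, Function.update_of_ne hk.ne']
  have hur := hξ.admissible_closedLoopControl h r
  have hle := hopt ξ hξ _ hur
  rw [key s, key r, r₀] at hle
  have n₁ : 0 ≤ ∑ k ∈ Finset.Ico (l + 1) d.N,
      d.gap P M Mb k (d.closedLoopState P s l ξ k) (d.closedLoopControl P s l ξ k) :=
    Finset.sum_nonneg fun k hk =>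
      (hreg k (Finset.mem_Ico.1 hk).1 (Finset.mem_Ico.1 hk).2).gap_nonneg _ _
  have n₂ : ∑ k ∈ Finset.Ico (l + 1) d.N,
      d.gap P M Mb k (d.closedLoopState P r l ξ k) (d.closedLoopControl P r l ξ k) = 0 := by
    refine Finset.sum_eq_zero fun k hk => ?_
    obtain ⟨h₁, h₂⟩ := Finset.mem_Ico.1 hk
    have hx := hξ.isL2_state_of_admissible h hur (Nat.le_of_succ_le h₁) h₂.le
    rw [d.state_closedLoopControl] at hx
    rw [Data.closedLoopControl, r₁ k _ h₁]
    exact Data.gap_gainStrategy hx.integrable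
  linarith

/-! ### Regularity from optimality -/

theorem range_le_of_forall_exists {p r t : ℕ} {H : Matrix (Fin p) (Fin t) ℝ}
    {U : Matrix (Fin p) (Fin r) ℝ} (h : ∀ c, ∃ w, U *ᵥ w = H *ᵥ c) :
    LinearMap.range H.mulVecLin ≤ LinearMap.range U.mulVecLin := by
  rintro _ ⟨c, rfl⟩
  obtain ⟨w, hw⟩ := h c
  exact ⟨w, hw⟩

theorem stageForm_smul (A : Matrix (Fin n) (Fin n) ℝ) (B : Matrix (Fin n) (Fin m) ℝ)
    (C : Matrix (Fin n) (Fin n) ℝ) (D : Matrix (Fin n) (Fin m) ℝ)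
    (P₁ P₂ Q : Matrix (Fin n) (Fin n) ℝ) (S : Matrix (Fin m) (Fin n) ℝ)
    (R : Matrix (Fin m) (Fin m) ℝ) (t : ℝ) (x : Fin n → ℝ) (u : Fin m → ℝ) :
    stageForm A B C D P₁ P₂ Q S R (t • x) (t • u)
      = t ^ 2 * stageForm A B C D P₁ P₂ Q S R x u := by
  simp only [stageForm, mulVec_smul, ← smul_add, smul_dotProduct, dotProduct_smul, smul_eq_mul]
  ring

theorem stageForm_zero (A : Matrix (Fin n) (Fin n) ℝ) (B : Matrix (Fin n) (Fin m) ℝ)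
    (C : Matrix (Fin n) (Fin n) ℝ) (D : Matrix (Fin n) (Fin m) ℝ)
    (P₁ P₂ Q : Matrix (Fin n) (Fin n) ℝ) (S : Matrix (Fin m) (Fin n) ℝ)
    (R : Matrix (Fin m) (Fin m) ℝ) : stageForm A B C D P₁ P₂ Q S R 0 0 = 0 := by
  simp [stageForm]

theorem Data.oneStepCost_const (d : Data Ω n m) (N Nb : Matrix (Fin n) (Fin n) ℝ)
    (s : Strategy n m) (k : ℕ) (c : Fin n → ℝ) :
    d.oneStepCost P N Nb k (fun _ => c) (s.feedback P k fun _ => c)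
      = d.meanForm N Nb k c (s.Θ k *ᵥ c + s.Θb k *ᵥ c + s.v k) := by
  simp [Data.oneStepCost, Strategy.feedback, Data.fluctuationForm, stageForm_zero]

/-- A centred state has control mean `v`, so the mean part of the cost does not depend on `Θ`, and
the fluctuation part scales with the variance of `η`. -/
theorem Data.oneStepCost_centred (d : Data Ω n m) (N Nb : Matrix (Fin n) (Fin n) ℝ)
    (s : Strategy n m) (k : ℕ) {η : Ω → ℝ} (hη : MemLp η 2 P) (h0 : ∫ ω, η ω ∂P = 0)
    (c : Fin n → ℝ) :
    d.oneStepCost P N Nb k (fun ω => η ω • c) (s.feedback P k fun ω => η ω • c)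
      = (∫ ω, η ω ^ 2 ∂P) * d.fluctuationForm N k c (s.Θ k *ᵥ c)
        + d.meanForm N Nb k 0 (s.v k) := by
  have hi : Integrable (fun ω => η ω • c) P := (hη.integrable one_le_two).smul_const c
  have e₀ : ∫ ω, η ω • c ∂P = 0 := by rw [integral_smul_const, h0, zero_smul]
  rw [Data.oneStepCost, integral_feedback s k hi, e₀]
  simp only [Strategy.feedback, e₀, mulVec_zero, add_zero, zero_add, sub_zero, mulVec_smul,
    add_sub_cancel_right, Data.fluctuationForm, stageForm_smul, integral_mul_const]

/-- Constant states make the optimal feedback a minimiser of the mean form, and states `η • c` make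
`s.Θ l *ᵥ c` a minimiser of the fluctuation form; `posSemidef_of_forall_le` applies to each. -/
theorem Data.IsClosedLoopOptimal.isRegularAt (h : d.IsMartingaleDifference P)
    (hd : d.IsHomogeneous) (hs : d.SymmetricWeights) (hG : d.IsGRESolution M Mb) (hl : l < d.N)
    (hreg : ∀ k, l < k → k < d.N → d.IsRegularAt M Mb k) {s : Strategy n m}
    (hopt : d.IsClosedLoopOptimal P l s) {η : Ω → ℝ} (hη : MemLp η 2 P)
    (h0 : ∫ ω, η ω ∂P = 0) (hpos : 0 < ∫ ω, η ω ^ 2 ∂P)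
    (hi : ∀ c, d.IsInitialState P l fun ω => η ω • c) (hn : 0 < n) :
    d.IsRegularAt M Mb l := by
  obtain ⟨hM, hMb⟩ := hG.transpose_eq hs (Nat.succ_le_of_lt hl)
  have mean : ∀ c, (d.UpsBar M Mb l).PosSemidef ∧
      d.UpsBar M Mb l *ᵥ (-(s.Θ l *ᵥ c + s.Θb l *ᵥ c + s.v l)) = d.HBar M Mb l *ᵥ c := by
    intro c
    refine posSemidef_of_forall_le (Data.transpose_UpsBar hs hl hM hMb) _ _ fun w => ?_
    have hle := hopt.oneStepCost_le h hd hs hG hl hreg (d.isInitialState_const l c)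
      ⟨0, 0, fun _ => w⟩
    rw [d.oneStepCost_const, d.oneStepCost_const, Data.meanForm_eq hM hMb,
      Data.meanForm_eq hM hMb] at hle
    simp only [Pi.zero_apply, zero_mulVec, zero_add] at hle
    linarith
  have fluct : ∀ c, c ≠ 0 → (d.Ups M l).PosSemidef ∧
      d.Ups M l *ᵥ (-(s.Θ l *ᵥ c)) = d.H M l *ᵥ c := by
    intro c hc
    refine posSemidef_of_forall_le (Data.transpose_Ups hs hl hM) _ _ fun w => ?_
    -- The rank-one gain sends `c` to the arbitrary vector `w`, which needs `c ≠ 0`. Keeping `s.v`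
    -- makes the mean contributions cancel.
    have hle := hopt.oneStepCost_le h hd hs hG hl hreg (hi c)
      ⟨fun _ => vecMulVec ((c ⬝ᵥ c)⁻¹ • w) c, 0, s.v⟩
    have hcc : c ⬝ᵥ c ≠ 0 := fun e => hc (dotProduct_self_eq_zero.1 e)
    have hw : vecMulVec ((c ⬝ᵥ c)⁻¹ • w) c *ᵥ c = w := by
      ext i
      simp only [vecMulVec_mulVec, Pi.smul_apply, MulOpposite.smul_eq_mul_unop,
        MulOpposite.unop_op, smul_eq_mul]
      field_simp
    rw [d.oneStepCost_centred _ _ _ _ hη h0, d.oneStepCost_centred _ _ _ _ hη h0] at hle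
    simp only [hw] at hle
    have hle' := le_of_mul_le_mul_left (le_of_add_le_add_right hle) hpos
    rw [Data.fluctuationForm_eq hM, Data.fluctuationForm_eq hM] at hle'
    linarith
  refine ⟨?_, (mean 0).1, range_le_of_forall_exists fun c => ?_,
    range_le_of_forall_exists fun c => ⟨_, (mean c).2⟩⟩
  -- Semidefiniteness needs just one nonzero test direction, which exists because `0 < n`.
  · refine (fluct (Pi.single ⟨0, hn⟩ 1) fun e => ?_).1
    simpa using congrFun e ⟨0, hn⟩
  · by_cases hc : c = 0
    · exact ⟨0, by rw [hc, mulVec_zero, mulVec_zero]⟩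
    · exact ⟨_, (fluct c hc).2⟩

/-! ### The Riccati recursion -/

/-- The Riccati recursion backwards in time: `j` is the time to the horizon. -/
noncomputable def Data.riccati (d : Data Ω n m) :
    ℕ → Matrix (Fin n) (Fin n) ℝ × Matrix (Fin n) (Fin n) ℝ
  | 0 => (d.G, d.G + d.Gb)
  | j + 1 =>
    let k := d.N - (j + 1)
    -- Constant sequences suffice, since the coefficients at time `k` read only the entry at `k +
    -- 1`.
    let M : ℕ → Matrix (Fin n) (Fin n) ℝ := fun _ => (d.riccati j).1
    let Mb : ℕ → Matrix (Fin n) (Fin n) ℝ := fun _ => (d.riccati j).2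
    (d.Q k + (d.A k)ᵀ * M (k + 1) * d.A k + (d.C k)ᵀ * M (k + 1) * d.C k
      - (d.H M k)ᵀ * pinv (d.Ups M k) * d.H M k,
    d.Q k + d.Qb k + (d.A k + d.Ab k)ᵀ * Mb (k + 1) * (d.A k + d.Ab k)
      + (d.C k + d.Cb k)ᵀ * M (k + 1) * (d.C k + d.Cb k)
      - (d.HBar M Mb k)ᵀ * pinv (d.UpsBar M Mb k) * d.HBar M Mb k)

/-- The recursion never breaks down, because the pseudo-inverse is defined without any assumption.
-/
theorem Data.isGRESolution_riccati (d : Data Ω n m) :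
    d.IsGRESolution (fun k => (d.riccati (d.N - k)).1) fun k => (d.riccati (d.N - k)).2 := by
  have e : ∀ k < d.N, d.N - k = d.N - (k + 1) + 1 := fun k hk => by omega
  have e' : ∀ k < d.N, d.N - (d.N - (k + 1) + 1) = k := fun k hk => by omega
  refine ⟨fun k hk => ?_, fun k hk => ?_, ?_, ?_⟩
  · simp only [e k hk, Data.riccati, e' k hk, Data.H, Data.Ups]
  · simp only [e k hk, Data.riccati, e' k hk, Data.HBar, Data.UpsBar]
  · simp only [Nat.sub_self, Data.riccati]
  · simp only [Nat.sub_self, Data.riccati]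

/-- From a nonconstant initial state one obtains a nontrivial centred scalar that can be used in
every direction. -/
theorem exists_centred_scalar (hξ : d.IsInitialState P 0 ξ)
    (hne : ¬ ∃ c : Fin n → ℝ, ξ =ᵐ[P] fun _ => c) :
    0 < n ∧ ∃ η : Ω → ℝ, MemLp η 2 P ∧ ∫ ω, η ω ∂P = 0 ∧ 0 < ∫ ω, η ω ^ 2 ∂P ∧
      ∀ l c, d.IsInitialState P l fun ω => η ω • c := by
  -- Some coordinate differs from its mean with positive probability; its deviation from the mean
  -- serves as `η`.
  have hi : ∃ i, ¬ (fun ω => ξ ω i) =ᵐ[P] fun _ => ∫ ω, ξ ω i ∂P := by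
    by_contra! hall
    refine hne ⟨fun i => ∫ ω, ξ ω i ∂P, ?_⟩
    filter_upwards [ae_all_iff.2 hall] with ω hω
    exact funext hω
  obtain ⟨i, hi⟩ := hi
  have hL : MemLp (fun ω => ξ ω i - ∫ ω', ξ ω' i ∂P) 2 P := (hξ.memLp.eval i).sub (memLp_const _)
  refine ⟨i.pos, _, hL, ?_, ?_, fun l c => ?_⟩
  · rw [integral_sub ((hξ.memLp.eval i).integrable one_le_two) (integrable_const _)]
    simp
  · refine lt_of_le_of_ne (integral_nonneg fun ω => sq_nonneg _) fun e => hi ?_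
    have hz := (integral_eq_zero_iff_of_nonneg (fun ω => sq_nonneg _) hL.integrable_sq).1 e.symm
    filter_upwards [hz] with ω hω
    exact sub_eq_zero.1 (pow_eq_zero_iff two_ne_zero |>.1 hω)
  · refine hξ.of_comap_le (Nat.zero_le l) ?_ ?_
    · exact memLp_pi_iff.2 fun j => (hL.mul_const (c j))
    · refine measurable_iff_comap_le.1 ?_
      have hm : Measurable[MeasurableSpace.comap ξ inferInstance] fun ω => ξ ω i :=
        (measurable_pi_apply i).comp (comap_measurable ξ)
      exact (hm.sub_const _).smul_const c

end Verification

section L2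

attribute [local instance] Matrix.frobeniusNormedAddCommGroup

/-- On a finite set with counting measure every function is square integrable. -/
theorem squareIntegrableOn {p r : ℕ} (N : ℕ) (K : ℕ → Matrix (Fin p) (Fin r) ℝ) :
    SquareIntegrableOn N K :=
  MemLp.of_discrete

end L2

end MFLQ

/-! ### Backward induction over the horizon -/

theorem theorem4p3 {Ω : Type*} [MeasurableSpace Ω] (P : Measure Ω) [IsProbabilityMeasure P]
    {n m : ℕ} (d : MFLQ.Data Ω n m)
    (hsymm : d.SymmetricWeights) (hlin : d.SquareIntegrableWeights P)
    (hnoise : d.IsMartingaleDifference P)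
    (hrich : ∃ ξ, d.IsInitialState P 0 ξ ∧ ¬ ∃ c : Fin n → ℝ, ξ =ᵐ[P] fun _ => c)
    (hsolv : d.ClosedLoopSolvable P) :
    d.GRERegularlySolvable := by
  obtain ⟨ξ, hξ, hne⟩ := hrich
  obtain ⟨hn, η, hη, h0, hpos, hi⟩ := MFLQ.exists_centred_scalar hξ hne
  have hG := d.homog.isGRESolution_riccati
  set M := fun k => (d.homog.riccati (d.homog.N - k)).1
  set Mb := fun k => (d.homog.riccati (d.homog.N - k)).2
  have hs : d.homog.SymmetricWeights := ⟨hsymm.1, hsymm.2, hsymm.3, hsymm.4, hsymm.5, hsymm.6⟩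
  have hm : d.homog.IsMartingaleDifference P := ⟨hnoise.1, hnoise.2, hnoise.3, hnoise.4⟩
  have key : ∀ j ≤ d.N, ∀ k, j ≤ k → k < d.N → d.homog.IsRegularAt M Mb k := by
    intro j hj
    induction hj using Nat.decreasingInduction with
    | self => exact fun k h₁ h₂ => absurd h₂ h₁.not_gt
    | of_succ j hj ih =>
      intro k h₁ h₂
      rcases h₁.eq_or_lt with rfl | h₁
      -- Each initial time brings its own optimal strategy; no consistency between the strategies at
      -- different times is needed.
      · obtain ⟨s, hopt⟩ := hsolv j hj
        exact (hopt.homog hnoise hlin hj.le).isRegularAt hm d.isHomogeneous_homog hs hG hj ih hη h0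
          hpos (fun c => ⟨(hi j c).1, (hi j c).2, (hi j c).3⟩) hn
      · exact ih k h₁ h₂
  have hreg : ∀ k < d.N, d.homog.IsRegularAt M Mb k :=
    fun k hk => key 0 (Nat.zero_le _) k (Nat.zero_le _) hk
  -- The equations and the regularity conditions involve only coefficients that homogenisation
  -- leaves unchanged, so they transfer to `d` by unfolding.
  exact ⟨M, Mb, ⟨hG.1, hG.2, hG.3, hG.4⟩, ⟨fun k hk => (hreg k hk).1, fun k hk => (hreg k hk).2,
    fun k hk => (hreg k hk).3, fun k hk => (hreg k hk).4, MFLQ.squareIntegrableOn _ _,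
    MFLQ.squareIntegrableOn _ _⟩⟩
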